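/- Let $(S,\mathfrak n)$ be a commutative noetherian local ring and let $\omega\in\mathfrak n$ be a non-zerodivisor. Let $\mathcal G$ be the class of finitely generated Gorenstein projective $S$-modules, that is, finitely generated modules $M$ with $\mathrm{Ext}^i_S(M,S)=0=\mathrm{Ext}^i_S(\mathrm{Hom}_S(M,S),S)$ for all $i\ge 1$ whose biduality map $M\to\mathrm{Hom}_S(\mathrm{Hom}_S(M,S),S)$ is an isomorphism. Let $\mathsf{Mon}(\omega,\mathcal G)$ be the category of monomorphisms $g_1\colon G_1\to G_0$ with $G_1,G_0\in\mathcal G$ and $\omega\,\mathrm{Coker}\,g_1=0$, with commutative squares as morphisms. Let $\mathsf{MF}(\omega,\mathcal G)$ be the category of pairs $(g_1\colon G_1\to G_0,\ g_0\colon G_0\to G_1)$ with $G_1,G_0\in\mathcal G$, $g_1g_0=\omega\cdot\mathrm{id}_{G_0}$ and $g_0g_1=\omega\cdot\mathrm{id}_{G_1}$, whose morphisms are the pairs $(\phi_1,\phi_0)$ commuting with both structure maps. In both categories the conflations are the sequences that are short exact in both components. Let $F\colon\mathsf{Mon}(\omega,\mathcal G)\to\mathsf{MF}(\omega,\mathcal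 G)$ be the functor that sends $g_1$ to $(g_1,g_0)$, where $g_0\colon G_0\to G_1$ is the unique homomorphism with $g_1g_0=\omega\cdot\mathrm{id}_{G_0}$ and $g_0g_1=\omega\cdot\mathrm{id}_{G_1}$, and that sends $(\phi_1,\phi_0)$ to $(\phi_1,\phi_0)$. Then $F$ is an equivalence of categories, it sends conflations to conflations, and it sends projective objects to projective objects. With the above conflations, both categories are Frobenius categories, so that their stable categories $\underline{\mathsf{Mon}}(\omega,\mathcal G)$ and $\underline{\mathsf{MF}}(\omega,\mathcal G)$ (the quotients by the morphisms that factor through projective objects) are triangulated: the suspension $\Sigma X$ is the cokernel of an inflation $X\to I(X)$ with $I(X)$ injective, and the distinguished triangles are those isomorphic to triangles $X\xrightarrow{u}Y\to Z\to\Sigma X$ in which $Z$ is the push-out of $u$ along $X\to I(X)$, and $Z\to\Sigma X$ vanishes on $Y$ and restricts to the projection $I(X)\to\Sigma X$ on $I(X)$. Finally, $F$ induces a functor $\underline F\colon\underline{\mathsf{Mon}}(\omega,\mathcal G)\to\underline{\mathsf{MF}}(\omega,\mathcal G)$, and $\underline F$ is an equivalence of triangulated categories: it is an equivalence of categories that commutes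 with the shift and sends distinguished triangles to distinguished triangles. -/

import Mathlib

open CategoryTheory CategoryTheory.Limits CategoryTheory.Pretriangulated

universe u v

namespace ExactFrobenius

section ExactCategories

variable {C : Type u} [Category.{v} C] [Preadditive C]

/-- `i` is an inflation (admissible monic): the first map of a pair in `E`. -/
def Inflation (E : ObjectProperty (ShortComplex C)) {A B : C} (i : A ⟶ B) : Prop :=
  ∃ (Z : C) (p : B ⟶ Z) (w : i ≫ p = 0), E (ShortComplex.mk i p w)

/-- `p` is a deflation (admissible epic): the second map of a pair in `E`. -/
def Deflation (E : ObjectProperty (ShortComplex C)) {B Z : C} (p : B ⟶ Z) : Prop :=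
  ∃ (A : C) (i : A ⟶ B) (w : i ≫ p = 0), E (ShortComplex.mk i p w)

/-- `(C, E)` is an exact category in the sense of Quillen: `C` is additive, `E` is an
isomorphism-closed class of kernel-cokernel pairs, and the axioms (E0), (E0ᵒᵖ), (E1), (E1ᵒᵖ),
(E2), (E2ᵒᵖ) hold. -/
structure IsExactCategory (E : ObjectProperty (ShortComplex C)) : Prop where
  hasZeroObject : HasZeroObject C
  hasBinaryBiproducts : HasBinaryBiproducts C
  closedUnderIso : E.IsClosedUnderIsomorphisms
  isKernel : ∀ X : ShortComplex C, E X → Nonempty (IsLimit (KernelFork.ofι X.f X.zero))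
  isCokernel : ∀ X : ShortComplex C, E X → Nonempty (IsColimit (CokernelCofork.ofπ X.g X.zero))
  inflation_id : ∀ A : C, Inflation E (𝟙 A)
  deflation_id : ∀ A : C, Deflation E (𝟙 A)
  inflation_comp : ∀ {A B D : C} (i : A ⟶ B) (j : B ⟶ D),
    Inflation E i → Inflation E j → Inflation E (i ≫ j)
  deflation_comp : ∀ {A B D : C} (p : A ⟶ B) (q : B ⟶ D),
    Deflation E p → Deflation E q → Deflation E (p ≫ q)
  pushout : ∀ {A B A' : C} (i : A ⟶ B) (f : A ⟶ A'), Inflation E i →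
    ∃ (B' : C) (f' : B ⟶ B') (i' : A' ⟶ B'), IsPushout i f f' i' ∧ Inflation E i'
  pullback : ∀ {B Z Z' : C} (p : B ⟶ Z) (f : Z' ⟶ Z), Deflation E p →
    ∃ (B' : C) (f' : B' ⟶ B) (p' : B' ⟶ Z'), IsPullback f' p' p f ∧ Deflation E p'

/-- Projective objects of an exact category: morphisms lift along deflations. -/
def IsProj (E : ObjectProperty (ShortComplex C)) (P : C) : Prop :=
  ∀ {B Z : C} (p : B ⟶ Z) (f : P ⟶ Z), Deflation E p → ∃ g : P ⟶ B, g ≫ p = f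

/-- Injective objects of an exact category: morphisms extend along inflations. -/
def IsInj (E : ObjectProperty (ShortComplex C)) (J : C) : Prop :=
  ∀ {A B : C} (i : A ⟶ B) (f : A ⟶ J), Inflation E i → ∃ g : B ⟶ J, i ≫ g = f

/-- `(C, E)` is a Frobenius category: an exact category with enough projectives and enough
injectives, in which the projective and the injective objects coincide. -/
class IsFrobenius (E : ObjectProperty (ShortComplex C)) : Prop where
  exact : IsExactCategory E
  enoughProjectives : ∀ X : C, ∃ (P : C) (p : P ⟶ X), IsProj E P ∧ Deflation E p
  enoughInjectives : ∀ X : C, ∃ (J : C) (i : X ⟶ J), IsInj E J ∧ Inflation E i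
  proj_iff_inj : ∀ X : C, IsProj E X ↔ IsInj E X

/-- Two parallel morphisms are stably equal if their difference factors through a projective. -/
def stableRel (E : ObjectProperty (ShortComplex C)) : HomRel C := fun X Y f g =>
  ∃ P : C, IsProj E P ∧ ∃ (a : X ⟶ P) (b : P ⟶ Y), a ≫ b = f - g

/-- The stable category: same objects, morphisms modulo those factoring through projectives. -/
abbrev StableCategory (E : ObjectProperty (ShortComplex C)) := CategoryTheory.Quotient (stableRel E)

/-- The projection functor onto the stable category. -/
abbrev toStable (E : ObjectProperty (ShortComplex C)) : C ⥤ StableCategory E :=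
  CategoryTheory.Quotient.functor (stableRel E)

variable (E : ObjectProperty (ShortComplex C))

lemma isProj_biprod [HasBinaryBiproducts C] {P Q : C} (hP : IsProj E P) (hQ : IsProj E Q) :
    IsProj E (P ⊞ Q) := by
  intro B Z p f hp
  obtain ⟨g₁, h₁⟩ := hP p (biprod.inl ≫ f) hp
  obtain ⟨g₂, h₂⟩ := hQ p (biprod.inr ≫ f) hp
  exact ⟨biprod.desc g₁ g₂, by ext <;> simp [h₁, h₂]⟩

lemma stableRel_add [IsFrobenius E] {X Y : C} {f₁ f₂ g₁ g₂ : X ⟶ Y}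
    (h : stableRel E f₁ f₂) (h' : stableRel E g₁ g₂) : stableRel E (f₁ + g₁) (f₂ + g₂) := by
  have := (IsFrobenius.exact (E := E)).hasBinaryBiproducts
  obtain ⟨P, hP, a, b, hab⟩ := h
  obtain ⟨Q, hQ, c, d, hcd⟩ := h'
  refine ⟨P ⊞ Q, isProj_biprod E hP hQ, biprod.lift a c, biprod.desc b d, ?_⟩
  rw [biprod.lift_desc, hab, hcd]
  abel

lemma isProj_zero {Z : C} (hZ : IsZero Z) : IsProj E Z :=
  fun _ _ _ => ⟨0, hZ.eq_of_src _ _⟩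

instance stableRel_congruence [IsFrobenius E] : Congruence (stableRel E) where
  comp_left := by
    rintro X Y Z f g g' ⟨P, hP, a, b, h⟩
    exact ⟨P, hP, f ≫ a, b, by rw [Category.assoc, h, Preadditive.comp_sub]⟩
  comp_right := by
    rintro X Y Z f f' g ⟨P, hP, a, b, h⟩
    exact ⟨P, hP, a, b ≫ g, by rw [← Category.assoc, h, Preadditive.sub_comp]⟩
  equivalence :=
    { refl := fun f => by
        have := (IsFrobenius.exact (E := E)).hasZeroObject
        obtain ⟨Z, hZ⟩ := HasZeroObject.zero (C := C)
        exact ⟨Z, isProj_zero E hZ, 0, 0, by simp⟩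
      symm := by
        rintro f g ⟨P, hP, a, b, h⟩
        exact ⟨P, hP, -a, b, by rw [Preadditive.neg_comp, h, neg_sub]⟩
      trans := by
        intro f g k h h'
        obtain ⟨P, hP, a, b, e⟩ := stableRel_add E h h'
        exact ⟨P, hP, a, b, by rw [e]; abel⟩ }

/-- Addition of stable classes is induced by addition of representatives. -/
noncomputable instance stablePreadditive [IsFrobenius E] : Preadditive (StableCategory E) :=
  CategoryTheory.Quotient.preadditive (stableRel E) (fun _ _ _ _ _ _ h h' => stableRel_add E h h')

instance toStable_additive [IsFrobenius E] : (toStable E).Additive :=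
  CategoryTheory.Quotient.functor_additive (stableRel E) (fun _ _ _ _ _ _ h h' => stableRel_add E h h')

instance stable_hasZeroObject [IsFrobenius E] : HasZeroObject (StableCategory E) := by
  have := (IsFrobenius.exact (E := E)).hasZeroObject
  obtain ⟨Z, hZ⟩ := HasZeroObject.zero (C := C)
  exact ⟨(toStable E).obj Z, (toStable E).map_isZero hZ⟩

/-! For every object `X` a conflation `X ⟶ I(X) ⟶ S(X)` with `I(X)` injective is chosen. -/

/-- The chosen injective object `I(X)`. -/
noncomputable def hull [IsFrobenius E] (X : C) : C :=
  (IsFrobenius.enoughInjectives (E := E) X).choose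

/-- The chosen inflation `X ⟶ I(X)`. -/
noncomputable def hullι [IsFrobenius E] (X : C) : X ⟶ hull E X :=
  (IsFrobenius.enoughInjectives (E := E) X).choose_spec.choose

lemma hull_isInj [IsFrobenius E] (X : C) : IsInj E (hull E X) :=
  (IsFrobenius.enoughInjectives (E := E) X).choose_spec.choose_spec.1

lemma hullι_inflation [IsFrobenius E] (X : C) : Inflation E (hullι E X) :=
  (IsFrobenius.enoughInjectives (E := E) X).choose_spec.choose_spec.2

/-- The chosen cosyzygy `S(X)`. -/
noncomputable def cosyz [IsFrobenius E] (X : C) : C := (hullι_inflation E X).choose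

/-- The chosen deflation `I(X) ⟶ S(X)`. -/
noncomputable def cosyzπ [IsFrobenius E] (X : C) : hull E X ⟶ cosyz E X :=
  (hullι_inflation E X).choose_spec.choose

lemma hullι_cosyzπ [IsFrobenius E] (X : C) : hullι E X ≫ cosyzπ E X = 0 :=
  (hullι_inflation E X).choose_spec.choose_spec.choose

lemma hull_conflation [IsFrobenius E] (X : C) :
    E (ShortComplex.mk (hullι E X) (cosyzπ E X) (hullι_cosyzπ E X)) :=
  (hullι_inflation E X).choose_spec.choose_spec.choose_spec

variable {E} in
lemma exists_desc [IsFrobenius E] {X Z : C} (k : hull E X ⟶ Z) (hk : hullι E X ≫ k = 0) :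
    ∃ l : cosyz E X ⟶ Z, cosyzπ E X ≫ l = k := by
  obtain ⟨hc⟩ := (IsFrobenius.exact (E := E)).isCokernel _ (hull_conflation E X)
  exact ⟨_, (CokernelCofork.IsColimit.desc' hc k hk).2⟩

variable {E} in
lemma cosyzπ_cancel [IsFrobenius E] {X Z : C} {k l : cosyz E X ⟶ Z}
    (h : cosyzπ E X ≫ k = cosyzπ E X ≫ l) : k = l := by
  obtain ⟨hc⟩ := (IsFrobenius.exact (E := E)).isCokernel _ (hull_conflation E X)
  exact Cofork.IsColimit.hom_ext hc h

/-- `b : S(X) ⟶ S(Y)` is induced by `f : X ⟶ Y`: there is a morphism of the chosen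
conflations with components `f`, some `a : I(X) ⟶ I(Y)`, and `b`. -/
def IsCosyzMap [IsFrobenius E] {X Y : C} (f : X ⟶ Y) (b : cosyz E X ⟶ cosyz E Y) : Prop :=
  ∃ a : hull E X ⟶ hull E Y, hullι E X ≫ a = f ≫ hullι E Y ∧ a ≫ cosyzπ E Y = cosyzπ E X ≫ b

lemma exists_isCosyzMap [IsFrobenius E] {X Y : C} (f : X ⟶ Y) :
    ∃ b : cosyz E X ⟶ cosyz E Y, IsCosyzMap E f b := by
  obtain ⟨a, ha⟩ := hull_isInj E Y (hullι E X) (f ≫ hullι E Y) (hullι_inflation E X)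
  obtain ⟨b, hb⟩ := exists_desc (E := E) (a ≫ cosyzπ E Y)
    (by rw [← Category.assoc, ha, Category.assoc, hullι_cosyzπ, comp_zero])
  exact ⟨b, a, ha, hb.symm⟩

lemma isCosyzMap_unique [IsFrobenius E] {X Y : C} {f f' : X ⟶ Y}
    {b b' : cosyz E X ⟶ cosyz E Y} (hf : stableRel E f f')
    (hb : IsCosyzMap E f b) (hb' : IsCosyzMap E f' b') : stableRel E b b' := by
  obtain ⟨P, hP, α, β, hαβ⟩ := hf
  obtain ⟨a, ha, hab⟩ := hb
  obtain ⟨a', ha', hab'⟩ := hb'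
  obtain ⟨α', hα'⟩ := (IsFrobenius.proj_iff_inj (E := E) P).1 hP (hullι E X) α
    (hullι_inflation E X)
  obtain ⟨k, hk⟩ := exists_desc (E := E) (a - a' - α' ≫ β ≫ hullι E Y) (by
    rw [Preadditive.comp_sub, Preadditive.comp_sub, ha, ha', reassoc_of% hα', reassoc_of% hαβ,
      Preadditive.sub_comp, sub_self])
  refine ⟨hull E Y, (IsFrobenius.proj_iff_inj (E := E) _).2 (hull_isInj E Y), k, cosyzπ E Y, ?_⟩
  apply cosyzπ_cancel (E := E)
  rw [← Category.assoc, hk, Preadditive.sub_comp, Preadditive.sub_comp, hab, hab',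
    Category.assoc, Category.assoc, hullι_cosyzπ, comp_zero, comp_zero, sub_zero,
    Preadditive.comp_sub]

lemma isCosyzMap_id [IsFrobenius E] (X : C) : IsCosyzMap E (𝟙 X) (𝟙 (cosyz E X)) :=
  ⟨𝟙 _, by simp, by simp⟩

lemma isCosyzMap_comp [IsFrobenius E] {X Y Z : C} {f : X ⟶ Y} {g : Y ⟶ Z}
    {b : cosyz E X ⟶ cosyz E Y} {c : cosyz E Y ⟶ cosyz E Z}
    (hb : IsCosyzMap E f b) (hc : IsCosyzMap E g c) : IsCosyzMap E (f ≫ g) (b ≫ c) := by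
  obtain ⟨a, ha, hab⟩ := hb
  obtain ⟨a', ha', hac⟩ := hc
  exact ⟨a ≫ a', by rw [reassoc_of% ha, ha', Category.assoc],
    by rw [Category.assoc, hac, reassoc_of% hab]⟩

lemma stableRel_refl [IsFrobenius E] {X Y : C} (f : X ⟶ Y) : stableRel E f f :=
  (stableRel_congruence E).equivalence.refl f

/-- The functor `C ⥤ StableCategory E` sending `X` to `S(X)` and `f` to the stable class of any
morphism `S(X) ⟶ S(Y)` induced by `f`. -/
noncomputable def suspensionAux [IsFrobenius E] : C ⥤ StableCategory E where
  obj X := (toStable E).obj (cosyz E X)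
  map f := (toStable E).map (exists_isCosyzMap E f).choose
  map_id X := by
    rw [← (toStable E).map_id]
    exact CategoryTheory.Quotient.sound _ (isCosyzMap_unique E (stableRel_refl E _)
      (exists_isCosyzMap E (𝟙 X)).choose_spec (isCosyzMap_id E X))
  map_comp f g := by
    rw [← (toStable E).map_comp]
    exact CategoryTheory.Quotient.sound _ (isCosyzMap_unique E (stableRel_refl E _)
      (exists_isCosyzMap E (f ≫ g)).choose_spec
      (isCosyzMap_comp E (exists_isCosyzMap E f).choose_spec (exists_isCosyzMap E g).choose_spec))

/-- The suspension functor (the inverse of the syzygy functor) of the stable category. -/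
noncomputable def suspension [IsFrobenius E] : StableCategory E ⥤ StableCategory E :=
  CategoryTheory.Quotient.lift (stableRel E) (suspensionAux E) (fun _ _ _ _ h =>
    CategoryTheory.Quotient.sound _ (isCosyzMap_unique E h (exists_isCosyzMap E _).choose_spec
      (exists_isCosyzMap E _).choose_spec))

/-- Standard triangles `X ⟶ Y ⟶ Z ⟶ S(X)`, before passing to the stable category: `Z` is a
push-out of `u : X ⟶ Y` along the chosen `X ⟶ I(X)`, and `w` is the morphism that vanishes on `Y`
and restricts to the chosen `I(X) ⟶ S(X)` on `I(X)`. -/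
def IsStandardTriangle [IsFrobenius E] {X Y Z : C} (u : X ⟶ Y) (v : Y ⟶ Z)
    (w : Z ⟶ cosyz E X) : Prop :=
  ∃ t : hull E X ⟶ Z, IsPushout u (hullι E X) v t ∧ v ≫ w = 0 ∧ t ≫ w = cosyzπ E X

/-- The sextuples `X ⟶ Y ⟶ Z ⟶ ΣX` in the stable category that are isomorphic to the image of a
standard triangle. -/
def IsHappelTriangle [IsFrobenius E] {X Y Z : StableCategory E} (f : X ⟶ Y) (g : Y ⟶ Z)
    (h : Z ⟶ (suspension E).obj X) : Prop :=
  ∃ (X' Y' Z' : C) (u : X' ⟶ Y') (v : Y' ⟶ Z') (w : Z' ⟶ cosyz E X'),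
    IsStandardTriangle E u v w ∧
    ∃ (a : (toStable E).obj X' ≅ X) (b : (toStable E).obj Y' ≅ Y) (c : (toStable E).obj Z' ≅ Z),
      (toStable E).map u ≫ b.hom = a.hom ≫ f ∧
      (toStable E).map v ≫ c.hom = b.hom ≫ g ∧
      (show (toStable E).obj Z' ⟶ (suspension E).obj ((toStable E).obj X') from
        (toStable E).map w) ≫ (suspension E).map a.hom = c.hom ≫ h

/-- The triangulated structure of the stable category of a Frobenius category (Happel), in the
format of Mathlib: a shift by `ℤ` whose value at `1` is identified with the suspension functor,
and a triangulated structure for it whose distinguished triangles are exactly the triangles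
isomorphic to standard ones. -/
class StableTriangulation [IsFrobenius E] where
  hasShift : HasShift (StableCategory E) ℤ
  additive : ∀ n : ℤ, (shiftFunctor (StableCategory E) n).Additive
  pretriangulated : Pretriangulated (StableCategory E)
  isTriangulated : IsTriangulated (StableCategory E)
  shiftIso : shiftFunctor (StableCategory E) (1 : ℤ) ≅ suspension E
  distinguished_iff : ∀ T : Triangle (StableCategory E),
    T ∈ distTriang (StableCategory E) ↔
      IsHappelTriangle E T.mor₁ T.mor₂ (T.mor₃ ≫ shiftIso.hom.app T.obj₁)

attribute [reducible, instance] StableTriangulation.hasShift StableTriangulation.pretriangulated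
attribute [instance] StableTriangulation.additive StableTriangulation.isTriangulated

end ExactCategories

end ExactFrobenius

namespace MonMF

open ExactFrobenius

section

variable {S : Type u} [CommRing S]

/-- Finitely generated Gorenstein projective modules (modules of G-dimension zero):
`Extⁱ(M, S) = 0 = Extⁱ(Hom(M, S), S)` for all `i ≥ 1`, and the biduality map is bijective. -/
structure IsGorensteinProjective (M : ModuleCat.{u} S) : Prop where
  finite : Module.Finite S M
  ext_eq_zero : ∀ i : ℕ, 1 ≤ i → Subsingleton (Abelian.Ext M (ModuleCat.of S S) i)
  ext_dual_eq_zero : ∀ i : ℕ, 1 ≤ i →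
    Subsingleton (Abelian.Ext (ModuleCat.of S (Module.Dual S M)) (ModuleCat.of S S) i)
  reflexive : Function.Bijective (Module.Dual.eval S M)

variable (ω : S)

/-- Monomorphisms between Gorenstein projective modules with cokernel annihilated by `ω`, as a
property of objects of the morphism category. -/
def monProperty : ObjectProperty (Arrow (ModuleCat.{u} S)) := fun f =>
  IsGorensteinProjective f.left ∧ IsGorensteinProjective f.right ∧
    Function.Injective f.hom.hom ∧ ∀ x : f.right ⧸ LinearMap.range f.hom.hom, ω • x = 0

/-- The monomorphism category `Mon(ω, 𝒢)`: a full subcategory of the morphism category. -/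
abbrev MonG := (monProperty ω).FullSubcategory

/-- The conflations of `Mon(ω, 𝒢)`: short exact sequences of the morphism category (that is,
short exact in both components) with all terms in `Mon(ω, 𝒢)`. -/
def monConflation : ObjectProperty (ShortComplex (MonG ω)) := fun X =>
  (Function.Injective X.f.hom.left.hom ∧ Function.Exact X.f.hom.left.hom X.g.hom.left.hom ∧
    Function.Surjective X.g.hom.left.hom) ∧
  (Function.Injective X.f.hom.right.hom ∧ Function.Exact X.f.hom.right.hom X.g.hom.right.hom ∧
    Function.Surjective X.g.hom.right.hom)

/-- A matrix factorization of Gorenstein projective modules: `d₁ : G₁ ⟶ G₀`, `d₀ : G₀ ⟶ G₁` with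
both composites equal to multiplication by `ω`. -/
structure MFG where
  G₁ : ModuleCat.{u} S
  G₀ : ModuleCat.{u} S
  gorenstein₁ : IsGorensteinProjective G₁
  gorenstein₀ : IsGorensteinProjective G₀
  d₁ : G₁ ⟶ G₀
  d₀ : G₀ ⟶ G₁
  d₁_d₀ : d₁ ≫ d₀ = ω • 𝟙 G₁
  d₀_d₁ : d₀ ≫ d₁ = ω • 𝟙 G₀

variable {ω}

namespace MFG

/-- Morphisms of matrix factorizations: pairs commuting with both structure maps. -/
@[ext]
structure Hom (X Y : MFG ω) where
  φ₁ : X.G₁ ⟶ Y.G₁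
  φ₀ : X.G₀ ⟶ Y.G₀
  comm₁ : X.d₁ ≫ φ₀ = φ₁ ≫ Y.d₁
  comm₀ : X.d₀ ≫ φ₁ = φ₀ ≫ Y.d₀

instance : Category (MFG ω) where
  Hom := Hom
  id X := ⟨𝟙 _, 𝟙 _, by simp, by simp⟩
  comp f g := ⟨f.φ₁ ≫ g.φ₁, f.φ₀ ≫ g.φ₀,
    by rw [← Category.assoc, f.comm₁, Category.assoc, g.comm₁, Category.assoc],
    by rw [← Category.assoc, f.comm₀, Category.assoc, g.comm₀, Category.assoc]⟩
  id_comp f := by apply Hom.ext <;> exact Category.id_comp _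
  comp_id f := by apply Hom.ext <;> exact Category.comp_id _
  assoc f g h := by apply Hom.ext <;> exact Category.assoc _ _ _

@[ext]
lemma hom_ext {X Y : MFG ω} {f g : X ⟶ Y} (h₁ : f.φ₁ = g.φ₁) (h₀ : f.φ₀ = g.φ₀) : f = g :=
  Hom.ext h₁ h₀

instance {X Y : MFG ω} : Zero (X ⟶ Y) := ⟨⟨0, 0, by simp, by simp⟩⟩

instance {X Y : MFG ω} : Add (X ⟶ Y) :=
  ⟨fun f g => ⟨f.φ₁ + g.φ₁, f.φ₀ + g.φ₀, by simp [f.comm₁, g.comm₁], by simp [f.comm₀, g.comm₀]⟩⟩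

instance {X Y : MFG ω} : Neg (X ⟶ Y) :=
  ⟨fun f => ⟨-f.φ₁, -f.φ₀, by simp [f.comm₁], by simp [f.comm₀]⟩⟩

/-- Morphisms are added componentwise. -/
instance {X Y : MFG ω} : AddCommGroup (X ⟶ Y) where
  add_assoc f g h := hom_ext (add_assoc f.φ₁ g.φ₁ h.φ₁) (add_assoc f.φ₀ g.φ₀ h.φ₀)
  zero_add f := hom_ext (zero_add f.φ₁) (zero_add f.φ₀)
  add_zero f := hom_ext (add_zero f.φ₁) (add_zero f.φ₀)
  add_comm f g := hom_ext (add_comm f.φ₁ g.φ₁) (add_comm f.φ₀ g.φ₀)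
  neg_add_cancel f := hom_ext (neg_add_cancel f.φ₁) (neg_add_cancel f.φ₀)
  nsmul := nsmulRec
  zsmul := zsmulRec

instance : Preadditive (MFG ω) where
  add_comp _ _ _ f g h := hom_ext (Preadditive.add_comp _ _ _ f.φ₁ g.φ₁ h.φ₁)
    (Preadditive.add_comp _ _ _ f.φ₀ g.φ₀ h.φ₀)
  comp_add _ _ _ f g h := hom_ext (Preadditive.comp_add _ _ _ f.φ₁ g.φ₁ h.φ₁)
    (Preadditive.comp_add _ _ _ f.φ₀ g.φ₀ h.φ₀)

end MFG

variable (ω) in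
/-- The conflations of `MF(ω, 𝒢)`: all sequences that are short exact in both components. -/
def mfConflation : ObjectProperty (ShortComplex (MFG ω)) := fun X =>
  (Function.Injective X.f.φ₁.hom ∧ Function.Exact X.f.φ₁.hom X.g.φ₁.hom ∧
    Function.Surjective X.g.φ₁.hom) ∧
  (Function.Injective X.f.φ₀.hom ∧ Function.Exact X.f.φ₀.hom X.g.φ₀.hom ∧
    Function.Surjective X.g.φ₀.hom)

/-- For `f : G₁ ⟶ G₀` in `Mon(ω, 𝒢)` there is exactly one `g` with `g ≫ f = ω` and `f ≫ g = ω`. -/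
lemma existsUnique_partner (X : MonG ω) : ∃! g : X.obj.right ⟶ X.obj.left,
    X.obj.hom ≫ g = ω • 𝟙 X.obj.left ∧ g ≫ X.obj.hom = ω • 𝟙 X.obj.right := by
  obtain ⟨-, -, hinj, hω⟩ := X.property
  have hmem : ∀ y : X.obj.right, ∃ x : X.obj.left, X.obj.hom.hom x = ω • y := fun y => by
    have h := hω (Submodule.Quotient.mk y)
    rw [← Submodule.Quotient.mk_smul, Submodule.Quotient.mk_eq_zero] at h
    exact h
  choose s hs using hmem
  have hs' : ∀ x, s (X.obj.hom.hom x) = ω • x := fun x => hinj (by rw [hs, map_smul])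
  let g : X.obj.right →ₗ[S] X.obj.left :=
    { toFun := s
      map_add' := fun a b => hinj (by rw [hs, map_add, hs, hs, smul_add])
      map_smul' := fun r a => hinj (by rw [hs, RingHom.id_apply, map_smul, hs, smul_comm]) }
  refine ⟨ModuleCat.ofHom g, ⟨?_, ?_⟩, ?_⟩
  · ext x
    exact hs' x
  · ext y
    exact hs y
  · rintro g' ⟨-, hg'⟩
    ext y
    apply hinj
    have h := congrArg (fun k => k.hom y) hg'
    exact h.trans (hs y).symm

/-- The unique morphism `g₀ : G₀ ⟶ G₁` whose composites with `g₁ : G₁ ⟶ G₀` are `ω`. -/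
noncomputable def partner (X : MonG ω) : X.obj.right ⟶ X.obj.left :=
  (existsUnique_partner X).choose

lemma hom_partner (X : MonG ω) : X.obj.hom ≫ partner X = ω • 𝟙 X.obj.left :=
  (existsUnique_partner X).choose_spec.1.1

lemma partner_hom (X : MonG ω) : partner X ≫ X.obj.hom = ω • 𝟙 X.obj.right :=
  (existsUnique_partner X).choose_spec.1.2

lemma partner_naturality {X Y : MonG ω} (f : X ⟶ Y) :
    partner X ≫ f.hom.left = f.hom.right ≫ partner Y := by
  have : Mono Y.obj.hom := (ModuleCat.mono_iff_injective _).2 Y.property.2.2.1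
  have hw : f.hom.left ≫ Y.obj.hom = X.obj.hom ≫ f.hom.right := f.hom.w
  rw [← cancel_mono Y.obj.hom, Category.assoc, Category.assoc, hw, partner_hom,
    ← Category.assoc, partner_hom]
  simp

/-- The functor `F : Mon(ω, 𝒢) ⥤ MF(ω, 𝒢)` that sends `g₁ : G₁ ⟶ G₀` to `(g₁, g₀)`, where `g₀` is
the unique morphism with both composites equal to `ω`, and `(φ₁, φ₀)` to `(φ₁, φ₀)`. -/
noncomputable def toMF (ω : S) : MonG ω ⥤ MFG ω where
  obj X :=
    { G₁ := X.obj.left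
      G₀ := X.obj.right
      gorenstein₁ := X.property.1
      gorenstein₀ := X.property.2.1
      d₁ := X.obj.hom
      d₀ := partner X
      d₁_d₀ := hom_partner X
      d₀_d₁ := partner_hom X }
  map f :=
    { φ₁ := f.hom.left
      φ₀ := f.hom.right
      comm₁ := f.hom.w.symm
      comm₀ := partner_naturality f }
  map_id _ := rfl
  map_comp _ _ := rfl

end

end MonMF

open ExactFrobenius MonMF

/-!
The functor `F` is an equivalence because `ω` is regular on Gorenstein projective modules: these
embed into their biduals, on which `ω` acts regularly. So the first map `g₁` of a matrix
factorization is injective, `g₁ g₀ = ω` says that `ω` annihilates its cokernel, and `g₀` is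
determined by `g₁`. A sequence in `Mon(ω, 𝒢)` is a conflation exactly when its image is one, both
conditions being about the same two sequences of modules. Everything else about `Mon(ω, 𝒢)` is
therefore transported along `F` (`IsFrobenius.of_isEquivalence`, `isProj_map_iff`), and it suffices
to treat `MF(ω, 𝒢)`.

For `MF(ω, 𝒢)` the point is the behaviour of `𝒢` in short exact sequences. Kernels of surjections
in `𝒢` lie in `𝒢`, and, by duality, so do cokernels of *admissible* monomorphisms, the injections
along which all linear forms extend (`IsGorensteinProjective.kernel`,
`IsGorensteinProjective.cokernel`). Hence the deflations are the componentwise surjections, the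
inflations are the componentwise admissible monomorphisms, and the axioms of an exact category are
verified on components. The contractible factorizations `(𝟙, ω)` and `(ω, 𝟙)` on finite free
modules represent the two component functors and their duals. Thus they are projective and
injective, and as every module in `𝒢` is a quotient of a finite free module and embeds admissibly
into one, they provide enough projectives and enough injectives; every projective and every
injective object is a retract of a sum of them.

That the stable category of a Frobenius category is triangulated is Happel's theorem
(`stableTriangulationOfShift`). It is proved with the suspension functor, which is an
autoequivalence but not strictly invertible. The shift by `ℤ` with the suspension as its value at
`1` is obtained from the category of spectra `X₀, X₁ = ΣX₀, …`, which is equivalent to the stable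
category and on which `ℤ` acts by reindexing (`exists_shift_of_isEquivalence`). Finally, an
equivalence that matches conflations induces an equivalence of stable categories which commutes
with the suspensions up to isomorphism. The shift of the source is chosen to be the one transported
from the target, so that compatibility with all of `ℤ` is automatic
(`exists_triangle_equivalence`).
-/

universe u' v'

/-! ### Exact categories -/

namespace ExactFrobenius

section Exact

variable {C : Type u} [Category.{v} C] [Preadditive C] {E : ObjectProperty (ShortComplex C)}

lemma IsExactCategory.mono_of_inflation (hE : IsExactCategory E) {A B : C} {i : A ⟶ B}
    (hi : Inflation E i) : Mono i := by
  obtain ⟨Z, p, w, h⟩ := hi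
  obtain ⟨hk⟩ := hE.isKernel _ h
  exact mono_of_isLimit_fork hk

lemma IsExactCategory.epi_of_deflation (hE : IsExactCategory E) {B Z : C} {p : B ⟶ Z}
    (hp : Deflation E p) : Epi p := by
  obtain ⟨A, i, w, h⟩ := hp
  obtain ⟨hk⟩ := hE.isCokernel _ h
  exact epi_of_isColimit_cofork hk

lemma IsExactCategory.exists_lift (hE : IsExactCategory E) {A B Z : C} {i : A ⟶ B} {p : B ⟶ Z}
    {w : i ≫ p = 0} (h : E (ShortComplex.mk i p w)) {T : C} (k : T ⟶ B) (hk : k ≫ p = 0) :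
    ∃ l : T ⟶ A, l ≫ i = k := by
  obtain ⟨hl⟩ := hE.isKernel _ h
  exact ⟨_, (KernelFork.IsLimit.lift' hl k hk).2⟩

lemma IsExactCategory.exists_desc (hE : IsExactCategory E) {A B Z : C} {i : A ⟶ B} {p : B ⟶ Z}
    {w : i ≫ p = 0} (h : E (ShortComplex.mk i p w)) {T : C} (k : B ⟶ T) (hk : i ≫ k = 0) :
    ∃ l : Z ⟶ T, p ≫ l = k := by
  obtain ⟨hl⟩ := hE.isCokernel _ h
  exact ⟨_, (CokernelCofork.IsColimit.desc' hl k hk).2⟩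

/-- Replacing the terms of a conflation by isomorphic objects gives a conflation. -/
lemma IsExactCategory.of_iso (hE : IsExactCategory E) {A B Z A' B' Z' : C} {i : A ⟶ B} {p : B ⟶ Z}
    {w : i ≫ p = 0} (h : E (ShortComplex.mk i p w)) {i' : A' ⟶ B'} {p' : B' ⟶ Z'}
    (w' : i' ≫ p' = 0) (a : A ≅ A') (b : B ≅ B') (c : Z ≅ Z')
    (h₁ : i ≫ b.hom = a.hom ≫ i') (h₂ : p ≫ c.hom = b.hom ≫ p') :
    E (ShortComplex.mk i' p' w') := by
  have := hE.closedUnderIso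
  exact E.prop_of_iso (ShortComplex.isoMk a b c h₁.symm h₂.symm) h

/-- The push-out of a conflation along a morphism out of its first term is a conflation. -/
lemma IsExactCategory.conflation_of_isPushout (hE : IsExactCategory E) {A B Z A' B' : C}
    {i : A ⟶ B} {p : B ⟶ Z} {w : i ≫ p = 0} (h : E (ShortComplex.mk i p w)) {f : A ⟶ A'}
    {i' : A' ⟶ B'} {f' : B ⟶ B'} (sq : IsPushout f i i' f') (p' : B' ⟶ Z) (w' : i' ≫ p' = 0)
    (hp' : f' ≫ p' = p) : E (ShortComplex.mk i' p' w') := by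
  obtain ⟨B₂, f₂, i₂, sq₂, Z₂, p₂, w₂, h₂⟩ := hE.pushout i f ⟨_, _, _, h⟩
  let b : B₂ ≅ B' := sq₂.flip.isoIsPushout _ _ sq
  have hb₁ : i₂ ≫ b.hom = i' := sq₂.flip.inl_isoIsPushout_hom _ _ sq
  have hb₂ : f₂ ≫ b.hom = f' := sq₂.flip.inr_isoIsPushout_hom _ _ sq
  obtain ⟨c, hc⟩ := hE.exists_desc h₂ (b.hom ≫ p') (by rw [reassoc_of% hb₁, w'])
  obtain ⟨d, hd⟩ := hE.exists_desc h (f₂ ≫ p₂) (by rw [sq₂.w_assoc, w₂, comp_zero])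
  have : Epi p := hE.epi_of_deflation ⟨_, _, _, h⟩
  have : Epi p₂ := hE.epi_of_deflation ⟨_, _, _, h₂⟩
  refine hE.of_iso h₂ w' (Iso.refl _) b ⟨c, d, ?_, ?_⟩ (by simp [hb₁]) hc
  · rw [← cancel_epi p₂, reassoc_of% hc]
    apply sq₂.hom_ext
    · rw [reassoc_of% hb₂, reassoc_of% hp', hd, Category.comp_id]
    · rw [reassoc_of% hb₁, reassoc_of% w', zero_comp, Category.comp_id, w₂]
  · rw [← cancel_epi p, reassoc_of% hd, hc, reassoc_of% hb₂, hp', Category.comp_id]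

end Exact

/-! ### The suspension of the stable category -/

section Stable

variable {C : Type u} [Category.{v} C] [Preadditive C] (E : ObjectProperty (ShortComplex C))
  [IsFrobenius E]

lemma hull_isProj (X : C) : IsProj E (hull E X) :=
  (IsFrobenius.proj_iff_inj (E := E) _).2 (hull_isInj E X)

variable {E}

lemma toStable_map_eq_iff {X Y : C} {f g : X ⟶ Y} :
    (toStable E).map f = (toStable E).map g ↔ stableRel E f g :=
  CategoryTheory.Quotient.functor_map_eq_iff _ _ _

lemma toStable_map_eq_of_factor {X Y J : C} {f g : X ⟶ Y} (hJ : IsInj E J) (a : X ⟶ J)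
    (b : J ⟶ Y) (h : f = g + a ≫ b) : (toStable E).map f = (toStable E).map g :=
  CategoryTheory.Quotient.sound _ ⟨J, (IsFrobenius.proj_iff_inj (E := E) J).2 hJ, a, b, by
    rw [h, add_sub_cancel_left]⟩

/-- Stably equal morphisms differ by a morphism that extends along the injective hull. -/
lemma exists_of_toStable_map_eq {X Y : C} {f g : X ⟶ Y}
    (h : (toStable E).map f = (toStable E).map g) :
    ∃ s : hull E X ⟶ Y, f = g + hullι E X ≫ s := by
  obtain ⟨P, hP, a, b, hab⟩ := toStable_map_eq_iff.1 h
  obtain ⟨k, hk⟩ := (IsFrobenius.proj_iff_inj (E := E) P).1 hP _ a (hullι_inflation E X)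
  exact ⟨k ≫ b, by rw [reassoc_of% hk, hab]; abel⟩

lemma isZero_toStable_of_isInj {J : C} (hJ : IsInj E J) : IsZero ((toStable E).obj J) := by
  rw [IsZero.iff_id_eq_zero, ← (toStable E).map_id, ← (toStable E).map_zero]
  exact toStable_map_eq_of_factor hJ (𝟙 J) (𝟙 J) (by simp)

instance (X : C) : Mono (hullι E X) :=
  (IsFrobenius.exact (E := E)).mono_of_inflation (hullι_inflation E X)

instance (X : C) : Epi (cosyzπ E X) :=
  (IsFrobenius.exact (E := E)).epi_of_deflation ⟨_, _, _, hull_conflation E X⟩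

lemma suspension_map_eq {X Y : C} {f : X ⟶ Y} {b : cosyz E X ⟶ cosyz E Y}
    (hb : IsCosyzMap E f b) :
    (suspension E).map ((toStable E).map f) = (toStable E).map b :=
  CategoryTheory.Quotient.sound _ (isCosyzMap_unique E (stableRel_refl E f)
    (exists_isCosyzMap E f).choose_spec hb)

lemma isCosyzMap_add {X Y : C} {f f' : X ⟶ Y} {b b' : cosyz E X ⟶ cosyz E Y}
    (h : IsCosyzMap E f b) (h' : IsCosyzMap E f' b') : IsCosyzMap E (f + f') (b + b') := by
  obtain ⟨a, h₁, h₂⟩ := h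
  obtain ⟨a', h₁', h₂'⟩ := h'
  exact ⟨a + a', by simp [h₁, h₁'], by simp [h₂, h₂']⟩

instance : (suspension E).Additive where
  map_add {X Y} f g := by
    obtain ⟨f, rfl⟩ := (toStable E).map_surjective (X := X.as) (Y := Y.as) f
    obtain ⟨g, rfl⟩ := (toStable E).map_surjective (X := X.as) (Y := Y.as) g
    obtain ⟨b, hb⟩ := exists_isCosyzMap E f
    obtain ⟨b', hb'⟩ := exists_isCosyzMap E g
    rw [← (toStable E).map_add, suspension_map_eq (isCosyzMap_add hb hb'), suspension_map_eq hb,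
      suspension_map_eq hb', (toStable E).map_add]
    rfl

instance : (suspension E).Faithful where
  map_injective {X Y} f g h := by
    obtain ⟨f, rfl⟩ := (toStable E).map_surjective (X := X.as) (Y := Y.as) f
    obtain ⟨g, rfl⟩ := (toStable E).map_surjective (X := X.as) (Y := Y.as) g
    obtain ⟨b, a, ha, hab⟩ := exists_isCosyzMap E f
    obtain ⟨b', a', ha', hab'⟩ := exists_isCosyzMap E g
    rw [suspension_map_eq ⟨a, ha, hab⟩, suspension_map_eq ⟨a', ha', hab'⟩] at h
    obtain ⟨P, hP, α, β, hαβ⟩ := toStable_map_eq_iff.1 h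
    obtain ⟨β', hβ'⟩ := hP (cosyzπ E Y.as) β ⟨_, _, _, hull_conflation E Y.as⟩
    obtain ⟨m, hm⟩ := (IsFrobenius.exact (E := E)).exists_lift (hull_conflation E Y.as)
      (a - a' - cosyzπ E X.as ≫ α ≫ β') (by
        simp only [Preadditive.sub_comp, Category.assoc, hβ', hαβ, hab, hab',
          Preadditive.comp_sub, sub_self])
    refine toStable_map_eq_of_factor (hull_isInj E X.as) (hullι E X.as) m ?_
    have h₀ := hullι_cosyzπ E X.as
    rw [← cancel_mono (hullι E Y.as), Preadditive.add_comp, Category.assoc, hm]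
    simp only [Preadditive.comp_sub, ha, ha', reassoc_of% h₀, zero_comp]
    abel

instance : (suspension E).Full where
  map_surjective {X Y} g := by
    obtain ⟨b, rfl⟩ := (toStable E).map_surjective (X := cosyz E X.as) (Y := cosyz E Y.as) g
    obtain ⟨a, ha⟩ := hull_isProj E X.as (cosyzπ E Y.as) (cosyzπ E X.as ≫ b)
      ⟨_, _, _, hull_conflation E Y.as⟩
    obtain ⟨f, hf⟩ := (IsFrobenius.exact (E := E)).exists_lift (hull_conflation E Y.as)
      (hullι E X.as ≫ a) (by
        have h₀ := hullι_cosyzπ E X.as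
        rw [Category.assoc, ha, reassoc_of% h₀, zero_comp])
    exact ⟨(toStable E).map f, suspension_map_eq ⟨a, hf.symm, ha⟩⟩

/-- The cosyzygies of `X` computed from two embeddings of `X` into injective objects are stably
isomorphic. -/
noncomputable def cosyzIso {X J J' K K' : C} {i : X ⟶ J} {p : J ⟶ K} {w : i ≫ p = 0}
    (h : E (ShortComplex.mk i p w)) {i' : X ⟶ J'} {p' : J' ⟶ K'} {w' : i' ≫ p' = 0}
    (h' : E (ShortComplex.mk i' p' w')) (hJ : IsInj E J) (hJ' : IsInj E J')
    {r : J ⟶ J'} {r' : J' ⟶ J} (hr : i ≫ r = i') (hr' : i' ≫ r' = i) {k : K ⟶ K'} {k' : K' ⟶ K}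
    (hk : p ≫ k = r ≫ p') (hk' : p' ≫ k' = r' ≫ p) :
    (toStable E).obj K ≅ (toStable E).obj K' where
  hom := (toStable E).map k
  inv := (toStable E).map k'
  hom_inv_id := by
    rw [← (toStable E).map_comp, ← (toStable E).map_id]
    obtain ⟨s, hs⟩ := (IsFrobenius.exact (E := E)).exists_desc h (r ≫ r' - 𝟙 J) (by
      simp [reassoc_of% hr, hr'])
    have : Epi p := (IsFrobenius.exact (E := E)).epi_of_deflation ⟨_, _, _, h⟩
    refine toStable_map_eq_of_factor hJ s p ?_
    rw [← cancel_epi p, Preadditive.comp_add, reassoc_of% hk, hk', reassoc_of% hs]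
    simp
  inv_hom_id := by
    rw [← (toStable E).map_comp, ← (toStable E).map_id]
    obtain ⟨s, hs⟩ := (IsFrobenius.exact (E := E)).exists_desc h' (r' ≫ r - 𝟙 J') (by
      simp [reassoc_of% hr', hr])
    have : Epi p' := (IsFrobenius.exact (E := E)).epi_of_deflation ⟨_, _, _, h'⟩
    refine toStable_map_eq_of_factor hJ' s p' ?_
    rw [← cancel_epi p', Preadditive.comp_add, reassoc_of% hk', hk, reassoc_of% hs]
    simp

instance : (suspension E).EssSurj where
  mem_essImage Y := by
    obtain ⟨P, p, hP, K, i, w, h⟩ := IsFrobenius.enoughProjectives (E := E) Y.as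
    have hPi : IsInj E P := (IsFrobenius.proj_iff_inj (E := E) P).1 hP
    obtain ⟨r, hr⟩ := hPi (hullι E K) i (hullι_inflation E K)
    obtain ⟨r', hr'⟩ := hull_isInj E K i (hullι E K) ⟨_, _, _, h⟩
    obtain ⟨k, hk⟩ := exists_desc (E := E) (r ≫ p) (by rw [reassoc_of% hr, w])
    obtain ⟨k', hk'⟩ := (IsFrobenius.exact (E := E)).exists_desc h (r' ≫ cosyzπ E K)
      (by rw [reassoc_of% hr', hullι_cosyzπ])
    exact ⟨(toStable E).obj K, ⟨cosyzIso (hull_conflation E K) h (hull_isInj E K) hPi hr hr'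
      hk hk'⟩⟩

instance : (suspension E).IsEquivalence where

/-! ### Standard triangles -/

/-- The stable class of a morphism `Z ⟶ S(X)`, as a morphism to the suspension of `X`. -/
noncomputable def connecting {X Z : C} (w : Z ⟶ cosyz E X) :
    (toStable E).obj Z ⟶ (suspension E).obj ((toStable E).obj X) :=
  (toStable E).map w

lemma connecting_eq {X Z : C} {w w' : Z ⟶ cosyz E X}
    (h : (toStable E).map w = (toStable E).map w') : connecting w = connecting w' := h

lemma map_comp_connecting {X Z Z' : C} (c : Z' ⟶ Z) (w : Z ⟶ cosyz E X) :
    (toStable E).map c ≫ connecting w = connecting (c ≫ w) :=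
  ((toStable E).map_comp c w).symm

lemma connecting_comp_map {X Y Z : C} (w : Z ⟶ cosyz E X) {u : X ⟶ Y}
    {b : cosyz E X ⟶ cosyz E Y} (hb : IsCosyzMap E u b) :
    connecting w ≫ (suspension E).map ((toStable E).map u) = connecting (w ≫ b) := by
  rw [suspension_map_eq hb]
  exact ((toStable E).map_comp w b).symm

lemma IsStandardTriangle.isHappelTriangle {X Y Z : C} {u : X ⟶ Y} {v : Y ⟶ Z}
    {w : Z ⟶ cosyz E X} (h : IsStandardTriangle E u v w) :
    IsHappelTriangle E ((toStable E).map u) ((toStable E).map v)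
      (connecting w) :=
  ⟨X, Y, Z, u, v, w, h, Iso.refl _, Iso.refl _, Iso.refl _,
    (Category.comp_id _).trans (Category.id_comp _).symm,
    (Category.comp_id _).trans (Category.id_comp _).symm, by
      change connecting w ≫ _ = _ ≫ connecting w
      simp⟩

lemma IsHappelTriangle.of_iso {X Y Z X' Y' Z' : StableCategory E} {f : X ⟶ Y} {g : Y ⟶ Z}
    {h : Z ⟶ (suspension E).obj X} (H : IsHappelTriangle E f g h) {f' : X' ⟶ Y'} {g' : Y' ⟶ Z'}
    {h' : Z' ⟶ (suspension E).obj X'} (a : X ≅ X') (b : Y ≅ Y') (c : Z ≅ Z')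
    (h₁ : f ≫ b.hom = a.hom ≫ f') (h₂ : g ≫ c.hom = b.hom ≫ g')
    (h₃ : h ≫ (suspension E).map a.hom = c.hom ≫ h') : IsHappelTriangle E f' g' h' := by
  obtain ⟨X₀, Y₀, Z₀, u, v, w, hs, a₀, b₀, c₀, e₁, e₂, e₃⟩ := H
  refine ⟨X₀, Y₀, Z₀, u, v, w, hs, a₀ ≪≫ a, b₀ ≪≫ b, c₀ ≪≫ c, ?_, ?_, ?_⟩
  · rw [Iso.trans_hom, Iso.trans_hom, reassoc_of% e₁, h₁, Category.assoc]
  · rw [Iso.trans_hom, Iso.trans_hom, reassoc_of% e₂, h₂, Category.assoc]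
  · change connecting w ≫ _ = _ at e₃
    change connecting w ≫ _ = _
    rw [Iso.trans_hom, Iso.trans_hom, Functor.map_comp, reassoc_of% e₃, h₃, Category.assoc]

variable (E) in
/-- Every morphism starts a standard triangle. -/
lemma exists_isStandardTriangle {X Y : C} (u : X ⟶ Y) :
    ∃ (Z : C) (v : Y ⟶ Z) (w : Z ⟶ cosyz E X), IsStandardTriangle E u v w := by
  obtain ⟨Z, t, v, sq, -⟩ := (IsFrobenius.exact (E := E)).pushout (hullι E X) u
    (hullι_inflation E X)
  exact ⟨Z, v, sq.flip.desc 0 (cosyzπ E X) (by rw [comp_zero, hullι_cosyzπ]), t, sq.flip,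
    sq.flip.inl_desc _ _ _, sq.flip.inr_desc _ _ _⟩

/-- An endomorphism of a push-out of `u : X ⟶ Y` along `j : X ⟶ J`, with `J` injective, is stably
the identity if it is the identity on `Y` and is induced by an endomorphism of `J` under `X`. -/
lemma toStable_map_eq_id_of_isPushout {X Y Z J : C} {u : X ⟶ Y} {j : X ⟶ J} {v : Y ⟶ Z} {t : J ⟶ Z}
    (sq : IsPushout u j v t) (hJ : IsInj E J) {e : Z ⟶ Z} {s : J ⟶ J} (hs : j ≫ s = j)
    (h₁ : v ≫ e = v) (h₂ : t ≫ e = s ≫ t) : (toStable E).map e = 𝟙 _ := by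
  rw [← (toStable E).map_id]
  refine toStable_map_eq_of_factor hJ
    (sq.desc 0 (s - 𝟙 J) (by rw [Preadditive.comp_sub, hs]; simp)) t ?_
  apply sq.hom_ext
  · simp [h₁]
  · simp [h₂]

/-- A triangle built from a push-out along any embedding `j : X ⟶ J` into an injective object,
instead of the chosen one, is distinguished. -/
lemma isHappelTriangle_of_isPushout {X Y Z J : C} {u : X ⟶ Y} {j : X ⟶ J} {v : Y ⟶ Z} {t : J ⟶ Z}
    (sq : IsPushout u j v t) (hJ : IsInj E J) (r : J ⟶ hull E X)
    (hr : j ≫ r = hullι E X) (w : Z ⟶ cosyz E X) (hv : v ≫ w = 0) (ht : t ≫ w = r ≫ cosyzπ E X) :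
    IsHappelTriangle E ((toStable E).map u) ((toStable E).map v)
      (connecting w) := by
  obtain ⟨Z', v', w', t', sq', hv', ht'⟩ := exists_isStandardTriangle E u
  obtain ⟨r', hr'⟩ := hJ (hullι E X) j (hullι_inflation E X)
  let c : Z ⟶ Z' := sq.desc v' (r ≫ t') (by rw [reassoc_of% hr, sq'.w])
  let c' : Z' ⟶ Z := sq'.desc v (r' ≫ t) (by rw [reassoc_of% hr', sq.w])
  let e : (toStable E).obj Z' ≅ (toStable E).obj Z :=
    { hom := (toStable E).map c'
      inv := (toStable E).map c
      hom_inv_id := by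
        rw [← (toStable E).map_comp]
        exact toStable_map_eq_id_of_isPushout sq' (hull_isInj E X) (s := r' ≫ r)
          (by rw [reassoc_of% hr', hr]) (by simp [c, c']) (by simp [c, c'])
      inv_hom_id := by
        rw [← (toStable E).map_comp]
        exact toStable_map_eq_id_of_isPushout sq hJ (s := r ≫ r')
          (by rw [reassoc_of% hr, hr']) (by simp [c, c']) (by simp [c, c']) }
  have hcw : c ≫ w' = w := by
    apply sq.hom_ext
    · simp [c, hv, hv']
    · simp [c, ht, ht']
  refine (IsStandardTriangle.isHappelTriangle ⟨t', sq', hv', ht'⟩).of_iso (Iso.refl _) (Iso.refl _)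
    e ((Category.comp_id _).trans (Category.id_comp _).symm) ?_ ?_
  · rw [Iso.refl_hom, Category.id_comp]
    change (toStable E).map v' ≫ (toStable E).map c' = _
    rw [← (toStable E).map_comp, sq'.inl_desc]
  · rw [Iso.refl_hom, CategoryTheory.Functor.map_id, Category.comp_id, ← Iso.inv_comp_eq]
    change (toStable E).map c ≫ connecting w' = connecting w
    rw [map_comp_connecting, hcw]

/-- A conflation gives a distinguished triangle, whose third morphism is the negative of the
connecting morphism. -/
lemma isHappelTriangle_of_conflation {X Y Z : C} {i : X ⟶ Y} {p : Y ⟶ Z} {w : i ≫ p = 0}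
    (h : E (ShortComplex.mk i p w)) (t : Y ⟶ hull E X) (ht : i ≫ t = hullι E X)
    (δ : Z ⟶ cosyz E X) (hδ : p ≫ δ = t ≫ cosyzπ E X) :
    IsHappelTriangle E ((toStable E).map i) ((toStable E).map p)
      (connecting (-δ)) := by
  obtain ⟨Z', v, w', s, sq, hv, hs⟩ := exists_isStandardTriangle E i
  have : Epi p := (IsFrobenius.exact (E := E)).epi_of_deflation ⟨_, _, _, h⟩
  let c : Z' ⟶ Z := sq.desc p 0 (by rw [comp_zero, w])
  obtain ⟨c', hc'⟩ := (IsFrobenius.exact (E := E)).exists_desc h (v - t ≫ s) (by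
    rw [Preadditive.comp_sub, reassoc_of% ht, sq.w, sub_self])
  let q : Z' ⟶ hull E X := sq.desc t (𝟙 _) (by rw [ht, Category.comp_id])
  have hvc : v ≫ c = p := sq.inl_desc _ _ _
  have hsc : s ≫ c = 0 := sq.inr_desc _ _ _
  have hvq : v ≫ q = t := sq.inl_desc _ _ _
  have hsq : s ≫ q = 𝟙 _ := sq.inr_desc _ _ _
  let e : (toStable E).obj Z' ≅ (toStable E).obj Z :=
    { hom := (toStable E).map c
      inv := (toStable E).map c'
      hom_inv_id := by
        rw [← (toStable E).map_comp, ← (toStable E).map_id]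
        refine (toStable_map_eq_of_factor (hull_isInj E X) q s ?_).symm
        apply sq.hom_ext
        · rw [Preadditive.comp_add, reassoc_of% hvc, hc', reassoc_of% hvq]
          simp
        · rw [Preadditive.comp_add, reassoc_of% hsc, reassoc_of% hsq]
          simp
      inv_hom_id := by
        rw [← (toStable E).map_comp, ← (toStable E).map_id]
        congr 1
        rw [← cancel_epi p, reassoc_of% hc']
        simp [hvc, hsc] }
  refine (IsStandardTriangle.isHappelTriangle ⟨s, sq, hv, hs⟩).of_iso (Iso.refl _) (Iso.refl _)
    e ((Category.comp_id _).trans (Category.id_comp _).symm) ?_ ?_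
  · rw [Iso.refl_hom, Category.id_comp]
    change (toStable E).map v ≫ (toStable E).map c = _
    rw [← (toStable E).map_comp, hvc]
  · rw [Iso.refl_hom, CategoryTheory.Functor.map_id, Category.comp_id]
    change connecting w' = (toStable E).map c ≫ connecting (-δ)
    rw [map_comp_connecting]
    apply connecting_eq
    refine toStable_map_eq_of_factor (hull_isInj E X) q (cosyzπ E X) ?_
    apply sq.hom_ext
    · rw [Preadditive.comp_add, reassoc_of% hvc, reassoc_of% hvq, hv, Preadditive.comp_neg, hδ]
      simp
    · rw [Preadditive.comp_add, reassoc_of% hsc, reassoc_of% hsq, hs]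
      simp

/-- Rotation of a standard triangle. -/
lemma IsStandardTriangle.rotate {X Y Z : C} {u : X ⟶ Y} {v : Y ⟶ Z} {w : Z ⟶ cosyz E X}
    (h : IsStandardTriangle E u v w) {b : cosyz E X ⟶ cosyz E Y} (hb : IsCosyzMap E u b) :
    IsHappelTriangle E ((toStable E).map v) (connecting w)
      (-(suspension E).map ((toStable E).map u)) := by
  have hneg : -(suspension E).map ((toStable E).map u) = connecting (-b) := by
    rw [suspension_map_eq hb]
    exact (toStable E).map_neg.symm
  rw [hneg]
  obtain ⟨t, sq, hv, ht⟩ := h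
  obtain ⟨a, ha, hab⟩ := hb
  refine isHappelTriangle_of_conflation
    ((IsFrobenius.exact (E := E)).conflation_of_isPushout (hull_conflation E X) sq w hv ht)
    (sq.desc (hullι E Y) a ha.symm) (sq.inl_desc _ _ _) b ?_
  apply sq.hom_ext
  · simp [reassoc_of% hv, hullι_cosyzπ]
  · simp [reassoc_of% ht, hab]

end Stable

end ExactFrobenius

/-! ### Shifts from autoequivalences -/

namespace ExactFrobenius

section Spectra

variable {D : Type u} [Category.{v} D]

/-- Spectra for an endofunctor `e`: sequences of objects indexed by `ℤ`, each of which is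
identified with the image under `e` of its predecessor. -/
structure Spectrum (e : D ⥤ D) where
  obj : ℤ → D
  iso : ∀ n, e.obj (obj n) ≅ obj (n + 1)

namespace Spectrum

variable {e : D ⥤ D}

/-- Morphisms of spectra: sequences of morphisms compatible with the structure isomorphisms. -/
@[ext]
structure Hom (X Y : Spectrum e) where
  app : ∀ n, X.obj n ⟶ Y.obj n
  comm : ∀ n, e.map (app n) ≫ (Y.iso n).hom = (X.iso n).hom ≫ app (n + 1)

instance : Category (Spectrum e) where
  Hom := Hom
  id X := ⟨fun _ => 𝟙 _, by simp⟩
  comp f g := ⟨fun n => f.app n ≫ g.app n, fun n => by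
    rw [e.map_comp, Category.assoc, g.comm, ← Category.assoc, f.comm, Category.assoc]⟩

@[ext]
lemma hom_ext {X Y : Spectrum e} {f g : X ⟶ Y} (h : ∀ n, f.app n = g.app n) : f = g :=
  Hom.ext (funext h)

@[simp] lemma comp_app {X Y Z : Spectrum e} (f : X ⟶ Y) (g : Y ⟶ Z) (n : ℤ) :
    Hom.app (f ≫ g) n = f.app n ≫ g.app n := rfl

/-- The component in degree zero. -/
@[simps]
def evalZero (e : D ⥤ D) : Spectrum e ⥤ D where
  obj X := X.obj 0
  map f := f.app 0

lemma app_eq_of_app_zero_eq [e.Faithful] {X Y : Spectrum e} {f g : X ⟶ Y}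
    (h : f.app 0 = g.app 0) (n : ℤ) : f.app n = g.app n := by
  induction n using Int.induction_on with
  | zero => exact h
  | succ n ih =>
    rw [← cancel_epi (X.iso n).hom, ← f.comm, ← g.comm, ih]
  | pred n ih =>
    generalize hm : -(n : ℤ) - 1 = m
    rw [show -(n : ℤ) = m + 1 by omega] at ih
    apply e.map_injective
    rw [← cancel_mono (Y.iso m).hom, f.comm, g.comm, ih]

instance [e.Faithful] : (evalZero e).Faithful where
  map_injective h := by
    ext n
    exact app_eq_of_app_zero_eq h n

section

variable [e.Full] [e.Faithful]

/-- The components in non-negative degrees of the extension of a morphism in degree zero. -/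
noncomputable def extendNat {X Y : Spectrum e} (f : X.obj 0 ⟶ Y.obj 0) :
    ∀ n : ℕ, X.obj (Int.ofNat n) ⟶ Y.obj (Int.ofNat n)
  | 0 => f
  | n + 1 => (X.iso (Int.ofNat n)).inv ≫ e.map (extendNat f n) ≫ (Y.iso (Int.ofNat n)).hom

/-- The components in negative degrees of the extension of a morphism in degree zero. -/
noncomputable def extendNeg {X Y : Spectrum e} (f : X.obj 0 ⟶ Y.obj 0) :
    ∀ n : ℕ, X.obj (Int.negSucc n) ⟶ Y.obj (Int.negSucc n)
  | 0 => e.preimage ((X.iso (Int.negSucc 0)).hom ≫ f ≫ (Y.iso (Int.negSucc 0)).inv)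
  | n + 1 => e.preimage ((X.iso (Int.negSucc (n + 1))).hom ≫ extendNeg f n ≫
      (Y.iso (Int.negSucc (n + 1))).inv)

/-- The extension of a morphism in degree zero to a morphism of spectra. -/
noncomputable def extend {X Y : Spectrum e} (f : X.obj 0 ⟶ Y.obj 0) : X ⟶ Y where
  app
    | Int.ofNat n => extendNat f n
    | Int.negSucc n => extendNeg f n
  comm
    | Int.ofNat n => by
      change _ = (X.iso (Int.ofNat n)).hom ≫ extendNat f (n + 1)
      simp [extendNat]
    | Int.negSucc 0 => by
      change e.map (extendNeg f 0) ≫ _ = (X.iso (Int.negSucc 0)).hom ≫ f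
      rw [extendNeg, e.map_preimage]
      simp only [Category.assoc]
      exact congrArg _ ((congrArg _ (Iso.inv_hom_id _)).trans (Category.comp_id _))
    | Int.negSucc (n + 1) => by
      change e.map (extendNeg f (n + 1)) ≫ _ =
        (X.iso (Int.negSucc (n + 1))).hom ≫ extendNeg f n
      rw [extendNeg, e.map_preimage]
      simp only [Category.assoc]
      exact congrArg _ ((congrArg _ (Iso.inv_hom_id _)).trans (Category.comp_id _))

instance : (evalZero e).Full where
  map_surjective f := ⟨extend f, rfl⟩

end

section

variable [e.IsEquivalence]

/-- The objects of the spectrum with a given object in degree zero. -/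
noncomputable def freeObj (e : D ⥤ D) [e.IsEquivalence] (X : D) : ℤ → D
  | Int.ofNat n => e.obj^[n] X
  | Int.negSucc n => e.inv.obj^[n + 1] X

/-- The spectrum with a given object in degree zero. -/
noncomputable def free (e : D ⥤ D) [e.IsEquivalence] (X : D) : Spectrum e where
  obj := freeObj e X
  iso
    | Int.ofNat n => eqToIso (Function.iterate_succ_apply' e.obj n X).symm
    | Int.negSucc 0 => e.asEquivalence.counitIso.app X
    | Int.negSucc (n + 1) =>
      e.mapIso (eqToIso (Function.iterate_succ_apply' e.inv.obj (n + 1) X)) ≪≫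
        e.asEquivalence.counitIso.app _

instance : (evalZero e).EssSurj where
  mem_essImage X := ⟨free e X, ⟨Iso.refl X⟩⟩

instance : (evalZero e).IsEquivalence where

end

lemma eqToHom_iso (X : Spectrum e) {a b : ℤ} (h : a = b) :
    e.map (eqToHom (congrArg X.obj h)) ≫ (X.iso b).hom =
      (X.iso a).hom ≫ eqToHom (by rw [h]) := by
  subst h
  simp

lemma app_eqToHom {X Y : Spectrum e} (f : X ⟶ Y) {a b : ℤ} (h : a = b) :
    f.app a ≫ eqToHom (congrArg Y.obj h) = eqToHom (congrArg X.obj h) ≫ f.app b := by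
  subst h
  simp

/-- Reindexing of spectra. -/
@[simps]
def reindex (e : D ⥤ D) (k : ℤ) : Spectrum e ⥤ Spectrum e where
  obj X :=
    { obj := fun n => X.obj (n + k)
      iso := fun n => X.iso (n + k) ≪≫ eqToIso (congrArg X.obj (by omega)) }
  map {X Y} f :=
    { app := fun n => f.app (n + k)
      comm := fun n => by
        have h : n + k + 1 = n + 1 + k := by omega
        have := app_eqToHom f h
        simp only [Iso.trans_hom, eqToIso.hom, Category.assoc, ← this]
        rw [← Category.assoc, f.comm, Category.assoc] }

/-- Spectra with equal structure maps up to a relabelling of the indices are isomorphic. -/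
@[simps]
def isoOfEq {X Y : Spectrum e} (h : ∀ n, X.obj n = Y.obj n)
    (h' : ∀ n, e.map (eqToHom (h n)) ≫ (Y.iso n).hom = (X.iso n).hom ≫ eqToHom (h (n + 1))) :
    X ≅ Y where
  hom := { app := fun n => eqToHom (h n), comm := h' }
  inv :=
    { app := fun n => eqToHom (h n).symm
      comm := fun n => by
        rw [← cancel_mono (eqToHom (h (n + 1))), Category.assoc, ← h', ← e.map_comp_assoc]
        simp }

/-- Reindexing by a sum is the composite of the reindexings. -/
def reindexAdd (e : D ⥤ D) (k l : ℤ) : reindex e (k + l) ≅ reindex e k ⋙ reindex e l :=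
  NatIso.ofComponents (fun X => isoOfEq (fun n => congrArg X.obj (by omega)) (fun n => by
      have h₁ : n + (k + l) = n + l + k := by omega
      have h₂ : n + l + k + 1 = n + l + 1 + k := by omega
      have h₃ : n + l + 1 + k = n + 1 + l + k := by omega
      have h₄ : n + (k + l) + 1 = n + 1 + (k + l) := by omega
      have h₅ : n + 1 + (k + l) = n + 1 + l + k := by omega
      change e.map (eqToHom (congrArg X.obj h₁)) ≫ ((X.iso (n + l + k)).hom ≫
        eqToHom (congrArg X.obj h₂)) ≫ eqToHom (congrArg X.obj h₃) =
          ((X.iso (n + (k + l))).hom ≫ eqToHom (congrArg X.obj h₄)) ≫ eqToHom (congrArg X.obj h₅)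
      simp only [Category.assoc, eqToHom_trans]
      rw [← Category.assoc, eqToHom_iso X h₁, Category.assoc, eqToHom_trans])) (fun f => by
      ext n
      exact app_eqToHom f (show n + (k + l) = n + l + k by omega))

/-- Reindexing by zero is the identity. -/
def reindexZero (e : D ⥤ D) : reindex e 0 ≅ 𝟭 _ :=
  NatIso.ofComponents (fun X => isoOfEq (fun n => congrArg X.obj (by omega)) (fun n => by
      have h₁ : n + 0 = n := by omega
      have h₂ : n + 0 + 1 = n + 1 + 0 := by omega
      have h₃ : n + 1 + 0 = n + 1 := by omega
      change e.map (eqToHom (congrArg X.obj h₁)) ≫ (X.iso n).hom =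
          ((X.iso (n + 0)).hom ≫ eqToHom (congrArg X.obj h₂)) ≫ eqToHom (congrArg X.obj h₃)
      rw [eqToHom_iso X h₁, Category.assoc, eqToHom_trans])) (fun f => by
      ext n
      exact app_eqToHom f (show n + 0 = n by omega))

lemma eqToHom_app' {X Y : Spectrum e} (h : X = Y) (n : ℤ) :
    Hom.app (eqToHom h) n = eqToHom (by rw [h]) := by
  subst h
  rfl

instance hasShift (e : D ⥤ D) : HasShift (Spectrum e) ℤ :=
  hasShiftMk _ _
    { F := reindex e
      zero := reindexZero e
      add := reindexAdd e
      assoc_hom_app := fun k l m X => by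
        ext n
        rw [comp_app, comp_app, comp_app, eqToHom_app']
        have h₁ : n + (k + l + m) = n + m + (k + l) := by omega
        have h₂ : n + m + (k + l) = n + m + l + k := by omega
        have h₃ : n + (k + l + m) = n + (k + (l + m)) := by omega
        have h₄ : n + (k + (l + m)) = n + (l + m) + k := by omega
        have h₅ : n + (l + m) + k = n + m + l + k := by omega
        exact show eqToHom (congrArg X.obj h₁) ≫ eqToHom (congrArg X.obj h₂) =
          eqToHom (congrArg X.obj h₃) ≫ eqToHom (congrArg X.obj h₄) ≫
            eqToHom (congrArg X.obj h₅) by simp only [eqToHom_trans]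
      zero_add_hom_app := fun k X => by
        ext n
        rw [comp_app, eqToHom_app']
        have h₁ : n + (0 + k) = n + k := by omega
        have h₂ : n + k = n + k + 0 := by omega
        have h₃ : n + (0 + k) = n + k + 0 := by omega
        exact show eqToHom (congrArg X.obj h₃) = eqToHom (congrArg X.obj h₁) ≫
          eqToHom (congrArg X.obj h₂) by simp only [eqToHom_trans]
      add_zero_hom_app := fun k X => by
        ext n
        rw [comp_app, eqToHom_app']
        have h₁ : n + (k + 0) = n + k := by omega
        have h₂ : n + k = n + 0 + k := by omega
        have h₃ : n + (k + 0) = n + 0 + k := by omega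
        exact show eqToHom (congrArg X.obj h₃) = eqToHom (congrArg X.obj h₁) ≫
          eqToHom (congrArg X.obj h₂) by simp only [eqToHom_trans] }

/-- The shift of spectra by one applies the endofunctor in degree zero. -/
def shiftOneEvalZero (e : D ⥤ D) :
    evalZero e ⋙ e ≅ shiftFunctor (Spectrum e) (1 : ℤ) ⋙ evalZero e :=
  NatIso.ofComponents (fun X => X.iso 0) (fun f => f.comm 0)

end Spectrum

/-- Every autoequivalence `e` is, up to isomorphism, the shift by `1` of a shift by `ℤ`: the
category is equivalent to the category of spectra for `e`, on which `ℤ` acts by reindexing. -/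
lemma exists_shift_of_isEquivalence (e : D ⥤ D) [e.IsEquivalence] :
    ∃ _ : HasShift D ℤ, Nonempty (shiftFunctor D (1 : ℤ) ≅ e) := by
  let V := Spectrum.evalZero e
  let G := V.inv
  let s : ℤ → D ⥤ D := fun n => G ⋙ shiftFunctor (Spectrum e) n ⋙ V
  let i : ∀ n, s n ⋙ G ≅ G ⋙ shiftFunctor (Spectrum e) n := fun n =>
    Functor.isoWhiskerLeft (G ⋙ shiftFunctor (Spectrum e) n) V.asEquivalence.unitIso.symm
  refine ⟨(Functor.FullyFaithful.ofFullyFaithful G).hasShift s i, ⟨?_⟩⟩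
  change s 1 ≅ e
  exact Functor.isoWhiskerLeft G (Spectrum.shiftOneEvalZero e).symm ≪≫
    Functor.isoWhiskerRight V.asEquivalence.counitIso e

end Spectra

end ExactFrobenius

/-! ### Happel's theorem -/

namespace ExactFrobenius

section Happel

open ZeroObject

variable {C : Type u} [Category.{v} C] [Preadditive C] {E : ObjectProperty (ShortComplex C)}
  [IsFrobenius E]

/-- Every distinguished triangle is isomorphic to the image of a standard triangle. -/
lemma IsHappelTriangle.exists_iso {X Y Z : StableCategory E} {f : X ⟶ Y} {g : Y ⟶ Z}
    {h : Z ⟶ (suspension E).obj X} (H : IsHappelTriangle E f g h) :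
    ∃ (X' Y' Z' : C) (u : X' ⟶ Y') (v : Y' ⟶ Z') (w : Z' ⟶ cosyz E X'),
      IsStandardTriangle E u v w ∧
      ∃ (a : (toStable E).obj X' ≅ X) (b : (toStable E).obj Y' ≅ Y) (c : (toStable E).obj Z' ≅ Z),
        (toStable E).map u ≫ b.hom = a.hom ≫ f ∧ (toStable E).map v ≫ c.hom = b.hom ≫ g ∧
        connecting w ≫ (suspension E).map a.hom = c.hom ≫ h :=
  H

lemma IsHappelTriangle.comp_eq_zero {X Y Z : StableCategory E} {f : X ⟶ Y} {g : Y ⟶ Z}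
    {h : Z ⟶ (suspension E).obj X} (H : IsHappelTriangle E f g h) : f ≫ g = 0 := by
  obtain ⟨X', Y', Z', u, v, w, ⟨t, sq, -, -⟩, a, b, c, h₁, h₂, -⟩ := H.exists_iso
  have huv : (toStable E).map u ≫ (toStable E).map v = 0 := by
    rw [← (toStable E).map_comp, ← (toStable E).map_zero]
    exact toStable_map_eq_of_factor (hull_isInj E X') (hullι E X') t (by rw [sq.w, zero_add])
  rw [← cancel_epi a.hom, ← reassoc_of% h₁, ← h₂, reassoc_of% huv, zero_comp, comp_zero]

/-- Morphisms out of the middle of a distinguished triangle that vanish on the first object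
factor through the third one. -/
lemma IsHappelTriangle.exact {X Y Z : StableCategory E} {f : X ⟶ Y} {g : Y ⟶ Z}
    {h : Z ⟶ (suspension E).obj X} (H : IsHappelTriangle E f g h) {W : StableCategory E}
    (k : Y ⟶ W) (hk : f ≫ k = 0) : ∃ l : Z ⟶ W, k = g ≫ l := by
  obtain ⟨X', Y', Z', u, v, w, ⟨t, sq, -, -⟩, a, b, c, h₁, h₂, -⟩ := H.exists_iso
  obtain ⟨k', hk'⟩ := (toStable E).map_surjective (X := Y') (Y := W.as) (b.hom ≫ k)
  have hu : (toStable E).map (u ≫ k') = (toStable E).map 0 := by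
    rw [(toStable E).map_comp, hk', (toStable E).map_zero, reassoc_of% h₁, hk, comp_zero]
  obtain ⟨s, hs⟩ := exists_of_toStable_map_eq hu
  refine ⟨c.inv ≫ (toStable E).map (sq.desc k' s (by rw [hs, zero_add])), ?_⟩
  rw [← cancel_epi b.hom, ← reassoc_of% h₂, c.hom_inv_id_assoc, ← (toStable E).map_comp,
    sq.inl_desc, hk']

lemma exists_isHappelTriangle {X Y : StableCategory E} (f : X ⟶ Y) :
    ∃ (Z : StableCategory E) (g : Y ⟶ Z) (h : Z ⟶ (suspension E).obj X),
      IsHappelTriangle E f g h := by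
  obtain ⟨u, rfl⟩ := (toStable E).map_surjective (X := X.as) (Y := Y.as) f
  obtain ⟨Z, v, w, h⟩ := exists_isStandardTriangle E u
  exact ⟨(toStable E).obj Z, (toStable E).map v, connecting w, h.isHappelTriangle⟩

lemma isHappelTriangle_id (X : StableCategory E) {Z : StableCategory E} (hZ : IsZero Z) :
    IsHappelTriangle E (𝟙 X) (0 : X ⟶ Z) 0 := by
  have h : IsStandardTriangle E (𝟙 X.as) (hullι E X.as) (cosyzπ E X.as) :=
    ⟨𝟙 _, IsPushout.of_horiz_isIso ⟨by simp⟩, hullι_cosyzπ E X.as, Category.id_comp _⟩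
  have hz := isZero_toStable_of_isInj (hull_isInj E X.as)
  have H := h.isHappelTriangle
  rw [(toStable E).map_id] at H
  refine H.of_iso (Iso.refl ((toStable E).obj X.as)) (Iso.refl _) (hz.iso hZ) ?_
    (hZ.eq_of_tgt _ _) (hz.eq_of_src _ _)
  exact rfl

lemma IsHappelTriangle.rotate {X Y Z : StableCategory E} {f : X ⟶ Y} {g : Y ⟶ Z}
    {h : Z ⟶ (suspension E).obj X} (H : IsHappelTriangle E f g h) :
    IsHappelTriangle E g h (-(suspension E).map f) := by
  obtain ⟨X', Y', Z', u, v, w, hs, a, b, c, h₁, h₂, h₃⟩ := H.exists_iso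
  obtain ⟨d, hd⟩ := exists_isCosyzMap E u
  refine (hs.rotate hd).of_iso b c ((suspension E).mapIso a) h₂ h₃ ?_
  rw [Functor.mapIso_hom, Preadditive.neg_comp, Preadditive.comp_neg,
    ← (suspension E).map_comp, ← (suspension E).map_comp, h₁]

/-- A commutative square between the first morphisms of distinguished triangles extends to a
morphism of triangles. -/
lemma IsHappelTriangle.exists_hom {X Y Z : StableCategory E} {f : X ⟶ Y} {g : Y ⟶ Z}
    {h : Z ⟶ (suspension E).obj X} (H : IsHappelTriangle E f g h) {X' Y' Z' : StableCategory E}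
    {f' : X' ⟶ Y'} {g' : Y' ⟶ Z'} {h' : Z' ⟶ (suspension E).obj X'}
    (H' : IsHappelTriangle E f' g' h') (a : X ⟶ X') (b : Y ⟶ Y') (hab : f ≫ b = a ≫ f') :
    ∃ c : Z ⟶ Z', g ≫ c = b ≫ g' ∧ h ≫ (suspension E).map a = c ≫ h' := by
  obtain ⟨X₁, Y₁, Z₁, u, v, w, ⟨t, sq, hv, ht⟩, α, β, γ, e₁, e₂, e₃⟩ := H.exists_iso
  obtain ⟨X₁', Y₁', Z₁', u', v', w', ⟨t', sq', hv', ht'⟩, α', β', γ', e₁', e₂', e₃'⟩ :=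
    H'.exists_iso
  obtain ⟨a₀, ha₀⟩ := (toStable E).map_surjective (X := X₁) (Y := X₁') (α.hom ≫ a ≫ α'.inv)
  obtain ⟨b₀, hb₀⟩ := (toStable E).map_surjective (X := Y₁) (Y := Y₁') (β.hom ≫ b ≫ β'.inv)
  have hu : (toStable E).map (u ≫ b₀) = (toStable E).map (a₀ ≫ u') := by
    rw [(toStable E).map_comp, (toStable E).map_comp, ha₀, hb₀, ← cancel_mono β'.hom]
    simp only [Category.assoc, e₁', Iso.inv_hom_id_assoc, Iso.inv_hom_id, Category.comp_id,
      reassoc_of% e₁, hab]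
  obtain ⟨s, hs⟩ := exists_of_toStable_map_eq hu
  obtain ⟨k, hk⟩ := hull_isInj E X₁' (hullι E X₁) (a₀ ≫ hullι E X₁') (hullι_inflation E X₁)
  obtain ⟨d, hd⟩ := exists_desc (E := E) (k ≫ cosyzπ E X₁')
    (by rw [reassoc_of% hk, hullι_cosyzπ, comp_zero])
  let c : Z₁ ⟶ Z₁' := sq.desc (b₀ ≫ v') (k ≫ t' + s ≫ v') (by
    rw [reassoc_of% hs, Preadditive.comp_add, reassoc_of% hk, ← sq'.w]
    simp)
  have hc₁ : v ≫ c = b₀ ≫ v' := sq.inl_desc _ _ _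
  have hc₂ : c ≫ w' = w ≫ d := by
    apply sq.hom_ext
    · rw [reassoc_of% hc₁, hv', reassoc_of% hv, comp_zero, zero_comp]
    · rw [sq.inr_desc_assoc, Preadditive.add_comp, Category.assoc, Category.assoc, hv', ht',
        comp_zero, add_zero, reassoc_of% ht, hd]
  refine ⟨γ.inv ≫ (toStable E).map c ≫ γ'.hom, ?_, ?_⟩
  · rw [← cancel_epi β.hom, ← reassoc_of% e₂, γ.hom_inv_id_assoc, ← Category.assoc,
      ← (toStable E).map_comp, hc₁, (toStable E).map_comp, hb₀]
    simp [e₂']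
  · rw [← cancel_epi γ.hom, ← reassoc_of% e₃, ← (suspension E).map_comp]
    have : α.hom ≫ a = (toStable E).map a₀ ≫ α'.hom := by simp [ha₀]
    rw [this, (suspension E).map_comp, ← Category.assoc,
      connecting_comp_map w (⟨k, hk, hd.symm⟩ : IsCosyzMap E a₀ d), ← hc₂, ← map_comp_connecting]
    simp [e₃']

/-- The five lemma for distinguished triangles. -/
lemma IsHappelTriangle.isIso {X Y Z : StableCategory E} {f : X ⟶ Y} {g : Y ⟶ Z}
    {h : Z ⟶ (suspension E).obj X} (H : IsHappelTriangle E f g h) {X' Y' Z' : StableCategory E}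
    {f' : X' ⟶ Y'} {g' : Y' ⟶ Z'} {h' : Z' ⟶ (suspension E).obj X'}
    (H' : IsHappelTriangle E f' g' h') (a : X ≅ X') (b : Y ≅ Y') (c : Z ⟶ Z')
    (h₁ : f ≫ b.hom = a.hom ≫ f') (h₂ : g ≫ c = b.hom ≫ g')
    (h₃ : h ≫ (suspension E).map a.hom = c ≫ h') : IsIso c := by
  have hepi : ∀ {W : StableCategory E} (k : Z' ⟶ W), c ≫ k = 0 → k = 0 := by
    intro W k hk
    obtain ⟨l, rfl⟩ := H'.rotate.exact k (by
      rw [← cancel_epi b.hom, comp_zero, ← reassoc_of% h₂, hk, comp_zero])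
    rw [← reassoc_of% h₃] at hk
    obtain ⟨m, hm⟩ := H.rotate.rotate.exact _ hk
    have hl : l = -(suspension E).map f' ≫ (suspension E).map b.inv ≫ m := by
      have h₄ : f' ≫ b.inv = a.inv ≫ f := by
        rw [Iso.comp_inv_eq, Category.assoc, h₁, a.inv_hom_id_assoc]
      rw [← Category.assoc, ← (suspension E).map_comp, h₄, (suspension E).map_comp,
        Category.assoc, ← Preadditive.comp_neg, ← Preadditive.neg_comp, ← hm, ← Category.assoc,
        ← (suspension E).map_comp, a.inv_hom_id, CategoryTheory.Functor.map_id, Category.id_comp]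
    have h₅ := H'.rotate.rotate.comp_eq_zero
    rw [hl, ← Preadditive.neg_comp, reassoc_of% h₅, zero_comp]
  obtain ⟨k, hk⟩ := H'.exact (b.inv ≫ g) (by
    have h₄ : f' ≫ b.inv = a.inv ≫ f := by
      rw [Iso.comp_inv_eq, Category.assoc, h₁, a.inv_hom_id_assoc]
    rw [reassoc_of% h₄, H.comp_eq_zero, comp_zero])
  obtain ⟨m, hm⟩ := H.rotate.exact (𝟙 Z - c ≫ k) (by
    rw [Preadditive.comp_sub, reassoc_of% h₂, ← hk]
    simp)
  have hc : c ≫ (k + h' ≫ (suspension E).map a.inv ≫ m) = 𝟙 Z := by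
    rw [Preadditive.comp_add, ← reassoc_of% h₃, ← (suspension E).map_comp_assoc, a.hom_inv_id,
      CategoryTheory.Functor.map_id, Category.id_comp, ← hm]
    abel
  refine ⟨_, hc, ?_⟩
  rw [← sub_eq_zero]
  apply hepi
  rw [Preadditive.comp_sub, reassoc_of% hc, Category.comp_id, sub_self]

lemma IsHappelTriangle.of_rotate {X Y Z : StableCategory E} {f : X ⟶ Y} {g : Y ⟶ Z}
    {h : Z ⟶ (suspension E).obj X} (H : IsHappelTriangle E g h (-(suspension E).map f)) :
    IsHappelTriangle E f g h := by
  -- After three rotations both triangles start with `-Σf`; compare them there and desuspend.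
  obtain ⟨Z', g', h', H'⟩ := exists_isHappelTriangle f
  obtain ⟨c, hc₁, hc₂⟩ := H.rotate.rotate.exists_hom H'.rotate.rotate.rotate (𝟙 _) (𝟙 _) (by simp)
  have : IsIso c := H.rotate.rotate.isIso H'.rotate.rotate.rotate (Iso.refl _) (Iso.refl _) c
    (by simp) hc₁ hc₂
  let e : Z ≅ Z' := (suspension E).preimageIso (asIso c)
  have he : (suspension E).map e.hom = c := (suspension E).map_preimage c
  refine H'.of_iso (Iso.refl _) (Iso.refl _) e.symm (by simp) ?_ ?_
  · rw [Iso.symm_hom, Iso.comp_inv_eq, Iso.refl_hom, Category.id_comp]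
    apply (suspension E).map_injective
    rw [(suspension E).map_comp, he]
    simpa using hc₁.symm
  · rw [Iso.symm_hom, Iso.refl_hom, CategoryTheory.Functor.map_id, Category.comp_id,
      Iso.eq_inv_comp]
    apply (suspension E).map_injective
    rw [(suspension E).map_comp, he]
    simpa using hc₂.symm

/-- The octahedral axiom, for suitable representatives of the three triangles involved. -/
lemma exists_octahedron {X₁ X₂ X₃ : C} (u₁₂ : X₁ ⟶ X₂) (u₂₃ : X₂ ⟶ X₃) :
    ∃ (Z₁₂ Z₂₃ Z₁₃ : StableCategory E) (v₁₂ : (toStable E).obj X₂ ⟶ Z₁₂)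
      (w₁₂ : Z₁₂ ⟶ (suspension E).obj ((toStable E).obj X₁)) (v₂₃ : (toStable E).obj X₃ ⟶ Z₂₃)
      (w₂₃ : Z₂₃ ⟶ (suspension E).obj ((toStable E).obj X₂)) (v₁₃ : (toStable E).obj X₃ ⟶ Z₁₃)
      (w₁₃ : Z₁₃ ⟶ (suspension E).obj ((toStable E).obj X₁)) (m₁ : Z₁₂ ⟶ Z₁₃) (m₃ : Z₁₃ ⟶ Z₂₃),
      IsHappelTriangle E ((toStable E).map u₁₂) v₁₂ w₁₂ ∧
      IsHappelTriangle E ((toStable E).map u₂₃) v₂₃ w₂₃ ∧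
      IsHappelTriangle E ((toStable E).map u₁₂ ≫ (toStable E).map u₂₃) v₁₃ w₁₃ ∧
      v₁₂ ≫ m₁ = (toStable E).map u₂₃ ≫ v₁₃ ∧ m₁ ≫ w₁₃ = w₁₂ ∧ v₁₃ ≫ m₃ = v₂₃ ∧
      w₁₃ ≫ (suspension E).map ((toStable E).map u₁₂) = m₃ ≫ w₂₃ ∧
      IsHappelTriangle E m₁ m₃ (w₂₃ ≫ (suspension E).map v₁₂) := by
  have hE := IsFrobenius.exact (E := E)
  obtain ⟨Z₁₂, v₁₂, w₁₂, h₁₂⟩ := exists_isStandardTriangle E u₁₂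
  obtain ⟨Z₁₃, v₁₃, w₁₃, h₁₃⟩ := exists_isStandardTriangle E (u₁₂ ≫ u₂₃)
  obtain ⟨t₁₂, sq₁₂, hv₁₂, ht₁₂⟩ := id h₁₂
  obtain ⟨t₁₃, sq₁₃, hv₁₃, ht₁₃⟩ := id h₁₃
  let m₁ : Z₁₂ ⟶ Z₁₃ := sq₁₂.desc (u₂₃ ≫ v₁₃) t₁₃ (by rw [← Category.assoc, sq₁₃.w])
  have hm₁ : v₁₂ ≫ m₁ = u₂₃ ≫ v₁₃ := sq₁₂.inl_desc _ _ _
  have hm₁' : t₁₂ ≫ m₁ = t₁₃ := sq₁₂.inr_desc _ _ _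
  -- The cone of `u₂₃` is computed by the injective hull of the cone of `u₁₂`.
  obtain ⟨Z₂₃, m₃, w, h⟩ := exists_isStandardTriangle E m₁
  obtain ⟨t, sq, hw, ht⟩ := id h
  have sqm : IsPushout u₂₃ v₁₂ v₁₃ m₁ :=
    IsPushout.of_left (by rw [hm₁']; exact sq₁₃) hm₁.symm sq₁₂
  have sq₂₃ : IsPushout u₂₃ (v₁₂ ≫ hullι E Z₁₂) (v₁₃ ≫ m₃) t := sqm.paste_vert sq
  have hinf : Inflation E (v₁₂ ≫ hullι E Z₁₂) :=
    hE.inflation_comp _ _ ⟨_, _, _, hE.conflation_of_isPushout (hull_conflation E X₁) sq₁₂ w₁₂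
      hv₁₂ ht₁₂⟩ (hullι_inflation E Z₁₂)
  obtain ⟨r, hr⟩ := hull_isInj E X₂ _ (hullι E X₂) hinf
  obtain ⟨a, ha⟩ := hull_isInj E Z₁₂ (hullι E X₂) (v₁₂ ≫ hullι E Z₁₂) (hullι_inflation E X₂)
  obtain ⟨d, hd⟩ := exists_desc (E := E) (a ≫ cosyzπ E Z₁₂)
    (by rw [reassoc_of% ha, hullι_cosyzπ, comp_zero])
  rw [Category.assoc] at hr
  have hb' : hullι E X₁ ≫ t₁₂ ≫ hullι E Z₁₂ ≫ r = u₁₂ ≫ hullι E X₂ := by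
    rw [← sq₁₂.w_assoc, hr]
  obtain ⟨b, hb⟩ := exists_desc (E := E) ((t₁₂ ≫ hullι E Z₁₂ ≫ r) ≫ cosyzπ E X₂)
    (by rw [← Category.assoc, hb', Category.assoc, hullι_cosyzπ, comp_zero])
  let w₂₃ : Z₂₃ ⟶ cosyz E X₂ := sq₂₃.desc 0 (r ≫ cosyzπ E X₂) (by
    rw [Category.assoc, reassoc_of% hr, hullι_cosyzπ, comp_zero])
  have hw₂₃ : (v₁₃ ≫ m₃) ≫ w₂₃ = 0 := sq₂₃.inl_desc _ _ _
  have hw₂₃' : t ≫ w₂₃ = r ≫ cosyzπ E X₂ := sq₂₃.inr_desc _ _ _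
  have h₂₃ := isHappelTriangle_of_isPushout sq₂₃ (hull_isInj E Z₁₂) r (by rw [Category.assoc, hr])
    w₂₃ hw₂₃ hw₂₃'
  refine ⟨(toStable E).obj Z₁₂, (toStable E).obj Z₂₃, (toStable E).obj Z₁₃, (toStable E).map v₁₂,
    connecting w₁₂, _, connecting w₂₃, (toStable E).map v₁₃, connecting w₁₃, (toStable E).map m₁,
    (toStable E).map m₃, h₁₂.isHappelTriangle, h₂₃, ?_, ?_, ?_, ?_, ?_, ?_⟩
  · rw [← (toStable E).map_comp]
    exact h₁₃.isHappelTriangle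
  · rw [← (toStable E).map_comp, ← (toStable E).map_comp, hm₁]
  · rw [map_comp_connecting]
    congr 1
    apply sq₁₂.hom_ext
    · rw [reassoc_of% hm₁, hv₁₃, hv₁₂, comp_zero]
    · rw [reassoc_of% hm₁', ht₁₃, ht₁₂]
  · rw [← (toStable E).map_comp]
  · rw [connecting_comp_map w₁₃ (⟨_, hb', hb.symm⟩ : IsCosyzMap E u₁₂ b), map_comp_connecting]
    congr 1
    apply sq₁₃.hom_ext
    · rw [reassoc_of% hv₁₃, zero_comp, ← Category.assoc, hw₂₃]
    · have ht' : t₁₃ ≫ m₃ = t₁₂ ≫ hullι E Z₁₂ ≫ t := by rw [← hm₁', Category.assoc, sq.w]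
      rw [reassoc_of% ht₁₃, hb, reassoc_of% ht', hw₂₃', Category.assoc, Category.assoc]
  · rw [connecting_comp_map w₂₃ (⟨a, ha, hd.symm⟩ : IsCosyzMap E v₁₂ d)]
    have hw' : connecting (w₂₃ ≫ d) = connecting w := by
      refine connecting_eq (toStable_map_eq_of_factor (hull_isInj E Z₁₂)
        (sq₂₃.desc 0 (r ≫ a - 𝟙 _) ?_) (cosyzπ E Z₁₂) ?_)
      · rw [Preadditive.comp_sub, Category.assoc, reassoc_of% hr, ha, Category.comp_id, sub_self,
          comp_zero]
      · apply sq₂₃.hom_ext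
        · rw [← Category.assoc, hw₂₃, Preadditive.comp_add, sq₂₃.inl_desc_assoc, Category.assoc, hw]
          simp
        · rw [reassoc_of% hw₂₃', hd, Preadditive.comp_add, ht, sq₂₃.inr_desc_assoc]
          simp
    rw [hw']
    exact h.isHappelTriangle

variable (E) in
/-- The stable category of a Frobenius category is triangulated, for any shift by `ℤ` whose value
at `1` is identified with the suspension. -/
@[reducible]
noncomputable def stableTriangulationOfShift [hS : HasShift (StableCategory E) ℤ]
    (φ : shiftFunctor (StableCategory E) (1 : ℤ) ≅ suspension E)
    [hA : ∀ n : ℤ, (shiftFunctor (StableCategory E) n).Additive] : StableTriangulation E :=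
  letI P : Pretriangulated (StableCategory E) :=
    { distinguishedTriangles := fun T =>
        IsHappelTriangle E T.mor₁ T.mor₂ (T.mor₃ ≫ φ.hom.app T.obj₁)
      isomorphic_distinguished := fun T hT T' e => by
        have e' := e.symm
        refine IsHappelTriangle.of_iso hT (Triangle.π₁.mapIso e') (Triangle.π₂.mapIso e')
          (Triangle.π₃.mapIso e') e'.hom.comm₁ e'.hom.comm₂ ?_
        have h₁ := φ.hom.naturality e'.hom.hom₁
        have h₂ := e'.hom.comm₃
        change _ ≫ (suspension E).map e'.hom.hom₁ = e'.hom.hom₃ ≫ _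
        rw [Category.assoc, ← h₁, reassoc_of% h₂]
      contractible_distinguished := fun X => by
        change IsHappelTriangle E (𝟙 X) (0 : X ⟶ 0) (0 ≫ φ.hom.app X)
        rw [zero_comp]
        exact isHappelTriangle_id X (isZero_zero _)
      distinguished_cocone_triangle := fun {X Y} f => by
        obtain ⟨Z, g, h, H⟩ := exists_isHappelTriangle f
        refine ⟨Z, g, h ≫ φ.inv.app X, ?_⟩
        change IsHappelTriangle E f g ((h ≫ φ.inv.app X) ≫ φ.hom.app X)
        rwa [Category.assoc, Iso.inv_hom_id_app, Category.comp_id]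
      rotate_distinguished_triangle := fun T => by
        have h₁ : (-T.mor₁⟦(1 : ℤ)⟧') ≫ φ.hom.app T.obj₂ =
            φ.hom.app T.obj₁ ≫ (-(suspension E).map T.mor₁) := by
          rw [Preadditive.comp_neg, Preadditive.neg_comp, φ.hom.naturality]
        have h₂ : IsHappelTriangle E T.mor₂ (T.mor₃ ≫ φ.hom.app T.obj₁)
            (-(suspension E).map T.mor₁) ↔ IsHappelTriangle E T.mor₂ T.mor₃
              ((-T.mor₁⟦(1 : ℤ)⟧') ≫ φ.hom.app T.obj₂) := by
          constructor
          · intro H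
            refine H.of_iso (Iso.refl _) (Iso.refl _) (φ.symm.app T.obj₁) (by simp) (by simp) ?_
            rw [h₁]
            simp
          · intro H
            refine H.of_iso (Iso.refl _) (Iso.refl _) (φ.app T.obj₁) (by simp) (by simp) ?_
            rw [h₁]
            simp
        exact ⟨fun H => h₂.1 (IsHappelTriangle.rotate H),
          fun H => IsHappelTriangle.of_rotate (h₂.2 H)⟩
      complete_distinguished_triangle_morphism := fun T T' hT hT' a b hab => by
        obtain ⟨c, hc₁, hc₂⟩ := IsHappelTriangle.exists_hom hT hT' a b hab
        refine ⟨c, hc₁, ?_⟩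
        have h₁ := φ.hom.naturality a
        rw [← cancel_mono (φ.hom.app T'.obj₁), Category.assoc, Category.assoc, ← hc₂, h₁,
          Category.assoc] }
  { hasShift := hS
    additive := hA
    pretriangulated := P
    isTriangulated := IsTriangulated.mk' (by
      intro X₁ X₂ X₃ u₁₂ u₂₃
      obtain ⟨u₁₂, rfl⟩ := (toStable E).map_surjective (X := X₁.as) (Y := X₂.as) u₁₂
      obtain ⟨u₂₃, rfl⟩ := (toStable E).map_surjective (X := X₂.as) (Y := X₃.as) u₂₃
      obtain ⟨Z₁₂, Z₂₃, Z₁₃, v₁₂, w₁₂, v₂₃, w₂₃, v₁₃, w₁₃, m₁, m₃, h₁₂, h₂₃, h₁₃, c₁, c₂, c₃, c₄,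
        h⟩ := exists_octahedron (E := E) u₁₂ u₂₃
      have key : ∀ {X Y Z : StableCategory E} {f : X ⟶ Y} {g : Y ⟶ Z}
          {h : Z ⟶ (suspension E).obj X}, IsHappelTriangle E f g h →
          Triangle.mk f g (h ≫ φ.inv.app X) ∈ distTriang (StableCategory E) := by
        intro X Y Z f g h H
        change IsHappelTriangle E f g ((h ≫ φ.inv.app X) ≫ φ.hom.app X)
        rwa [Category.assoc, Iso.inv_hom_id_app, Category.comp_id]
      refine ⟨_, _, _, Z₁₂, Z₂₃, Z₁₃, (toStable E).map u₁₂, (toStable E).map u₂₃, Iso.refl _,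
        Iso.refl _, Iso.refl _, (Category.comp_id _).trans (Category.id_comp _).symm,
        (Category.comp_id _).trans (Category.id_comp _).symm, v₁₂, _, key h₁₂,
        v₂₃, _, key h₂₃, v₁₃, _, key h₁₃, ⟨⟨m₁, m₃, c₁, ?_, c₃, ?_, ?_⟩⟩⟩
      · rw [← Category.assoc, c₂]
      · have := φ.inv.naturality ((toStable E).map u₁₂)
        rw [Category.assoc, ← this, reassoc_of% c₄]
      · have := φ.inv.naturality v₁₂
        rw [Category.assoc, ← this, ← Category.assoc]
        exact key h)
    shiftIso := φ
    distinguished_iff := fun T => Iff.rfl }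

end Happel

end ExactFrobenius

/-! ### Transport along equivalences -/

namespace ExactFrobenius

section Transfer

variable {C : Type u} [Category.{v} C] [Preadditive C] {D : Type u'} [Category.{v'} D]
  [Preadditive D] {E : ObjectProperty (ShortComplex C)} {E' : ObjectProperty (ShortComplex D)}
  {F : C ⥤ D} [F.Additive] [F.IsEquivalence]
  (hF : ∀ X : ShortComplex C, E X ↔ E' (X.map F))

include hF

lemma inflation_map_iff (hE' : IsExactCategory E') {A B : C} (i : A ⟶ B) :
    Inflation E' (F.map i) ↔ Inflation E i := by
  constructor
  · rintro ⟨Z, p, w, h⟩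
    let e := F.objObjPreimageIso Z
    have hw : i ≫ F.preimage (p ≫ e.inv) = 0 := F.map_injective (by
      rw [F.map_comp, F.map_preimage, reassoc_of% w, zero_comp, F.map_zero])
    refine ⟨F.objPreimage Z, F.preimage (p ≫ e.inv), hw, (hF _).2 ?_⟩
    exact hE'.of_iso (i' := F.map i) (p' := F.map (F.preimage (p ≫ e.inv))) h
      (by rw [← F.map_comp, hw, F.map_zero]) (Iso.refl _) (Iso.refl _) e.symm (by simp) (by simp)
  · rintro ⟨Z, p, w, h⟩
    exact ⟨F.obj Z, F.map p, by rw [← F.map_comp, w, F.map_zero], (hF _).1 h⟩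

lemma deflation_map_iff (hE' : IsExactCategory E') {B Z : C} (p : B ⟶ Z) :
    Deflation E' (F.map p) ↔ Deflation E p := by
  constructor
  · rintro ⟨A, i, w, h⟩
    let e := F.objObjPreimageIso A
    have hw : F.preimage (e.hom ≫ i) ≫ p = 0 := F.map_injective (by
      rw [F.map_comp, F.map_preimage, Category.assoc, w, comp_zero, F.map_zero])
    refine ⟨F.objPreimage A, F.preimage (e.hom ≫ i), hw, (hF _).2 ?_⟩
    exact hE'.of_iso (i' := F.map (F.preimage (e.hom ≫ i))) (p' := F.map p) h
      (by rw [← F.map_comp, hw, F.map_zero]) e.symm (Iso.refl _) (Iso.refl _) (by simp) (by simp)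
  · rintro ⟨A, i, w, h⟩
    exact ⟨F.obj A, F.map i, by rw [← F.map_comp, w, F.map_zero], (hF _).1 h⟩

lemma isProj_map_iff (hE' : IsExactCategory E') {P : C} :
    IsProj E' (F.obj P) ↔ IsProj E P := by
  constructor
  · intro h B Z p f hp
    obtain ⟨g, hg⟩ := h (F.map p) (F.map f) ((deflation_map_iff hF hE' p).2 hp)
    exact ⟨F.preimage g, F.map_injective (by simp [hg])⟩
  · intro h B Z p f ⟨A, i, w, hp⟩
    let eB := F.objObjPreimageIso B
    let eZ := F.objObjPreimageIso Z
    obtain ⟨g, hg⟩ := h (F.preimage (eB.hom ≫ p ≫ eZ.inv)) (F.preimage (f ≫ eZ.inv)) (by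
      rw [← deflation_map_iff hF hE', F.map_preimage]
      have hw : (i ≫ eB.inv) ≫ eB.hom ≫ p ≫ eZ.inv = 0 := by simp [reassoc_of% w]
      exact ⟨A, i ≫ eB.inv, hw, hE'.of_iso hp hw (Iso.refl _) eB.symm eZ.symm
        (by simp) (by simp)⟩)
    refine ⟨F.map g ≫ eB.hom, ?_⟩
    have := congrArg F.map hg
    rw [F.map_comp, F.map_preimage, F.map_preimage] at this
    rw [← cancel_mono eZ.inv, ← this]
    simp

lemma isInj_map_iff (hE' : IsExactCategory E') {J : C} :
    IsInj E' (F.obj J) ↔ IsInj E J := by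
  constructor
  · intro h A B i f hi
    obtain ⟨g, hg⟩ := h (F.map i) (F.map f) ((inflation_map_iff hF hE' i).2 hi)
    exact ⟨F.preimage g, F.map_injective (by simp [hg])⟩
  · intro h A B i f ⟨Z, p, w, hi⟩
    let eA := F.objObjPreimageIso A
    let eB := F.objObjPreimageIso B
    obtain ⟨g, hg⟩ := h (F.preimage (eA.hom ≫ i ≫ eB.inv)) (F.preimage (eA.hom ≫ f)) (by
      rw [← inflation_map_iff hF hE', F.map_preimage]
      have hw : (eA.hom ≫ i ≫ eB.inv) ≫ eB.hom ≫ p = 0 := by simp [w]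
      exact ⟨Z, eB.hom ≫ p, hw, hE'.of_iso hi hw eA.symm eB.symm (Iso.refl _)
        (by simp) (by simp)⟩)
    refine ⟨eB.inv ≫ F.map g, ?_⟩
    have := congrArg F.map hg
    rw [F.map_comp, F.map_preimage, F.map_preimage] at this
    rw [← cancel_epi eA.hom, ← this]
    simp

/-- An exact structure that corresponds to an exact structure under an equivalence. -/
lemma IsExactCategory.of_isEquivalence (hE' : IsExactCategory E') : IsExactCategory E where
  hasZeroObject := by
    have := hE'.hasZeroObject
    obtain ⟨Z, hZ⟩ := HasZeroObject.zero (C := D)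
    refine ⟨F.objPreimage Z, ?_⟩
    rw [IsZero.iff_id_eq_zero]
    apply F.map_injective
    exact (hZ.of_iso (F.objObjPreimageIso Z)).eq_of_src _ _
  hasBinaryBiproducts := by
    have := hE'.hasBinaryBiproducts
    have : HasBinaryProducts C := Adjunction.hasLimitsOfShape_of_equivalence F
    exact HasBinaryBiproducts.of_hasBinaryProducts
  closedUnderIso :=
    { of_iso := fun {X Y} e hX => by
        have := hE'.closedUnderIso
        exact (hF Y).2 (E'.prop_of_iso (F.mapShortComplex.mapIso e) ((hF X).1 hX)) }
  isKernel X hX := by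
    have h := (hF X).1 hX
    have hm : Mono (F.map X.f) := hE'.mono_of_inflation ⟨_, _, _, h⟩
    have : Mono X.f := F.mono_of_mono_map hm
    refine ⟨KernelFork.IsLimit.ofι' _ _ (fun k hk => ?_)⟩
    have hl := hE'.exists_lift h (F.map k) (by
      rw [← F.map_comp, hk, F.map_zero])
    refine ⟨F.preimage hl.choose, F.map_injective ?_⟩
    rw [F.map_comp, F.map_preimage]
    exact hl.choose_spec
  isCokernel X hX := by
    have h := (hF X).1 hX
    have hm : Epi (F.map X.g) := hE'.epi_of_deflation ⟨_, _, _, h⟩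
    have : Epi X.g := F.epi_of_epi_map hm
    refine ⟨CokernelCofork.IsColimit.ofπ' _ _ (fun k hk => ?_)⟩
    have hl := hE'.exists_desc h (F.map k) (by
      rw [← F.map_comp, hk, F.map_zero])
    refine ⟨F.preimage hl.choose, F.map_injective ?_⟩
    rw [F.map_comp, F.map_preimage]
    exact hl.choose_spec
  inflation_id A := (inflation_map_iff hF hE' _).1 (by
    rw [F.map_id]
    exact hE'.inflation_id _)
  deflation_id A := (deflation_map_iff hF hE' _).1 (by
    rw [F.map_id]
    exact hE'.deflation_id _)
  inflation_comp i j hi hj := (inflation_map_iff hF hE' _).1 (by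
    rw [F.map_comp]
    exact hE'.inflation_comp _ _ ((inflation_map_iff hF hE' _).2 hi)
      ((inflation_map_iff hF hE' _).2 hj))
  deflation_comp p q hp hq := (deflation_map_iff hF hE' _).1 (by
    rw [F.map_comp]
    exact hE'.deflation_comp _ _ ((deflation_map_iff hF hE' _).2 hp)
      ((deflation_map_iff hF hE' _).2 hq))
  pushout i f hi := by
    obtain ⟨B', f', i', sq, Z, p, w, h⟩ := hE'.pushout (F.map i) (F.map f)
      ((inflation_map_iff hF hE' _).2 hi)
    let e := F.objObjPreimageIso B'
    refine ⟨F.objPreimage B', F.preimage (f' ≫ e.inv), F.preimage (i' ≫ e.inv), ?_, ?_⟩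
    · apply IsPushout.of_map F
      · apply F.map_injective
        simp [sq.w_assoc]
      · exact sq.of_iso (Iso.refl _) (Iso.refl _) (Iso.refl _) e.symm (by simp) (by simp)
          (by simp) (by simp)
    · rw [← inflation_map_iff hF hE', F.map_preimage]
      have hw : (i' ≫ e.inv) ≫ e.hom ≫ p = 0 := by simp [w]
      exact ⟨Z, e.hom ≫ p, hw, hE'.of_iso h hw (Iso.refl _) e.symm (Iso.refl _)
        (by simp) (by simp)⟩
  pullback p f hp := by
    obtain ⟨B', f', p', sq, A, i, w, h⟩ := hE'.pullback (F.map p) (F.map f)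
      ((deflation_map_iff hF hE' _).2 hp)
    let e := F.objObjPreimageIso B'
    refine ⟨F.objPreimage B', F.preimage (e.hom ≫ f'), F.preimage (e.hom ≫ p'), ?_, ?_⟩
    · apply IsPullback.of_map F
      · apply F.map_injective
        simp [sq.w]
      · exact sq.of_iso e.symm (Iso.refl _) (Iso.refl _) (Iso.refl _) (by simp) (by simp)
          (by simp) (by simp)
    · rw [← deflation_map_iff hF hE', F.map_preimage]
      have hw : (i ≫ e.inv) ≫ e.hom ≫ p' = 0 := by simp [w]
      exact ⟨A, i ≫ e.inv, hw, hE'.of_iso h hw (Iso.refl _) e.symm (Iso.refl _)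
        (by simp) (by simp)⟩

/-- A conflation structure that corresponds to that of a Frobenius category under an equivalence
makes the category a Frobenius category. -/
lemma IsFrobenius.of_isEquivalence [hE' : IsFrobenius E'] : IsFrobenius E where
  exact := IsExactCategory.of_isEquivalence hF hE'.exact
  enoughProjectives X := by
    obtain ⟨P, p, hP, A, i, w, h⟩ := hE'.enoughProjectives (F.obj X)
    let e := F.objObjPreimageIso P
    refine ⟨F.objPreimage P, F.preimage (e.hom ≫ p), ?_, ?_⟩
    · rw [← isProj_map_iff hF hE'.exact]
      intro B Z q f hq
      obtain ⟨g, hg⟩ := hP q (e.inv ≫ f) hq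
      exact ⟨e.hom ≫ g, by rw [Category.assoc, hg, e.hom_inv_id_assoc]⟩
    · rw [← deflation_map_iff hF hE'.exact, F.map_preimage]
      have hw : (i ≫ e.inv) ≫ e.hom ≫ p = 0 := by simp [w]
      exact ⟨A, i ≫ e.inv, hw, hE'.exact.of_iso h hw (Iso.refl _) e.symm (Iso.refl _)
        (by simp) (by simp)⟩
  enoughInjectives X := by
    obtain ⟨J, i, hJ, Z, p, w, h⟩ := hE'.enoughInjectives (F.obj X)
    let e := F.objObjPreimageIso J
    refine ⟨F.objPreimage J, F.preimage (i ≫ e.inv), ?_, ?_⟩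
    · rw [← isInj_map_iff hF hE'.exact]
      intro A B q f hq
      obtain ⟨g, hg⟩ := hJ q (f ≫ e.hom) hq
      exact ⟨g ≫ e.inv, by rw [← Category.assoc, hg, Category.assoc, e.hom_inv_id,
        Category.comp_id]⟩
    · rw [← inflation_map_iff hF hE'.exact, F.map_preimage]
      have hw : (i ≫ e.inv) ≫ e.hom ≫ p = 0 := by simp [w]
      exact ⟨Z, e.hom ≫ p, hw, hE'.exact.of_iso h hw (Iso.refl _) e.symm (Iso.refl _)
        (by simp) (by simp)⟩
  proj_iff_inj X := by
    rw [← isProj_map_iff hF hE'.exact, ← isInj_map_iff hF hE'.exact]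
    exact hE'.proj_iff_inj _

variable [IsFrobenius E] [IsFrobenius E']

lemma stableRel_map_iff {X Y : C} (f g : X ⟶ Y) :
    stableRel E' (F.map f) (F.map g) ↔ stableRel E f g := by
  have hE' := IsFrobenius.exact (E := E')
  constructor
  · rintro ⟨P, hP, a, b, hab⟩
    -- The injective hull of `X` lies in the image of `F`, unlike `P`.
    obtain ⟨k, hk⟩ := (IsFrobenius.proj_iff_inj (E := E') P).1 hP (F.map (hullι E X)) a
      ((inflation_map_iff hF hE' _).2 (hullι_inflation E X))
    refine ⟨hull E X, hull_isProj E X, hullι E X, F.preimage (k ≫ b), F.map_injective ?_⟩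
    rw [F.map_comp, F.map_preimage, reassoc_of% hk, hab, F.map_sub]
  · rintro ⟨P, hP, a, b, hab⟩
    exact ⟨F.obj P, (isProj_map_iff hF hE').2 hP, F.map a, F.map b, by
      rw [← F.map_comp, hab, F.map_sub]⟩

variable (F)

/-- The functor between stable categories induced by an equivalence that matches the
conflations. -/
@[reducible]
noncomputable def stableFunctor : StableCategory E ⥤ StableCategory E' :=
  CategoryTheory.Quotient.lift (stableRel E) (F ⋙ toStable E') (fun _ _ _ _ h =>
    CategoryTheory.Quotient.sound _ ((stableRel_map_iff hF _ _).2 h))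

lemma stableFunctor_map {X Y : C} (f : X ⟶ Y) :
    (stableFunctor F hF).map ((toStable E).map f) = (toStable E').map (F.map f) := rfl

lemma stableFunctor_full : (stableFunctor F hF).Full where
  map_surjective {X Y} g := by
    obtain ⟨g, rfl⟩ := (toStable E').map_surjective (X := F.obj X.as) (Y := F.obj Y.as) g
    exact ⟨(toStable E).map (F.preimage g), by rw [stableFunctor_map, F.map_preimage]⟩

lemma stableFunctor_faithful : (stableFunctor F hF).Faithful where
  map_injective {X Y} f g h := by
    obtain ⟨f, rfl⟩ := (toStable E).map_surjective (X := X.as) (Y := Y.as) f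
    obtain ⟨g, rfl⟩ := (toStable E).map_surjective (X := X.as) (Y := Y.as) g
    exact toStable_map_eq_iff.2 ((stableRel_map_iff hF _ _).1 (toStable_map_eq_iff.1 h))

lemma stableFunctor_essSurj : (stableFunctor F hF).EssSurj where
  mem_essImage Y := ⟨(toStable E).obj (F.objPreimage Y.as),
    ⟨(toStable E').mapIso (F.objObjPreimageIso Y.as)⟩⟩

lemma stableFunctor_isEquivalence : (stableFunctor F hF).IsEquivalence where
  full := stableFunctor_full F hF
  faithful := stableFunctor_faithful F hF
  essSurj := stableFunctor_essSurj F hF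

lemma stableFunctor_additive : (stableFunctor F hF).Additive where
  map_add {X Y} f g := by
    obtain ⟨f, rfl⟩ := (toStable E).map_surjective (X := X.as) (Y := Y.as) f
    obtain ⟨g, rfl⟩ := (toStable E).map_surjective (X := X.as) (Y := Y.as) g
    rw [← (toStable E).map_add, stableFunctor_map, F.map_add, (toStable E').map_add]
    rfl

omit [F.IsEquivalence] [IsFrobenius E'] in
lemma map_hull_conflation (X : C) :
    E' (ShortComplex.mk (F.map (hullι E X)) (F.map (cosyzπ E X))
      (by rw [← F.map_comp, hullι_cosyzπ, F.map_zero])) :=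
  (hF _).1 (hull_conflation E X)

omit [F.IsEquivalence] in
lemma exists_hull_comparison (X : C) :
    ∃ (r : F.obj (hull E X) ⟶ hull E' (F.obj X)) (k : F.obj (cosyz E X) ⟶ cosyz E' (F.obj X)),
      F.map (hullι E X) ≫ r = hullι E' (F.obj X) ∧
        F.map (cosyzπ E X) ≫ k = r ≫ cosyzπ E' (F.obj X) := by
  obtain ⟨r, hr⟩ := hull_isInj E' (F.obj X) (F.map (hullι E X)) (hullι E' (F.obj X))
    ⟨_, _, _, map_hull_conflation F hF X⟩
  obtain ⟨k, hk⟩ := (IsFrobenius.exact (E := E')).exists_desc (map_hull_conflation F hF X)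
    (r ≫ cosyzπ E' (F.obj X)) (by rw [reassoc_of% hr, hullι_cosyzπ])
  exact ⟨r, k, hr, hk⟩

/-- A comparison of the image of the chosen hull of `X` with the chosen hull of the image. -/
noncomputable def hullComparison (X : C) : F.obj (hull E X) ⟶ hull E' (F.obj X) :=
  (exists_hull_comparison F hF X).choose

/-- The comparison of cosyzygies that is induced by the comparison of hulls. -/
noncomputable def cosyzComparison (X : C) : F.obj (cosyz E X) ⟶ cosyz E' (F.obj X) :=
  (exists_hull_comparison F hF X).choose_spec.choose

omit [F.IsEquivalence] in
lemma map_hullι_hullComparison (X : C) :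
    F.map (hullι E X) ≫ hullComparison F hF X = hullι E' (F.obj X) :=
  (exists_hull_comparison F hF X).choose_spec.choose_spec.1

omit [F.IsEquivalence] in
lemma map_cosyzπ_cosyzComparison (X : C) :
    F.map (cosyzπ E X) ≫ cosyzComparison F hF X = hullComparison F hF X ≫ cosyzπ E' (F.obj X) :=
  (exists_hull_comparison F hF X).choose_spec.choose_spec.2

lemma isIso_toStable_map_cosyzComparison (X : C) :
    IsIso ((toStable E').map (cosyzComparison F hF X)) := by
  have hJ : IsInj E' (F.obj (hull E X)) :=
    (isInj_map_iff hF (IsFrobenius.exact (E := E'))).2 (hull_isInj E X)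
  have h := map_hull_conflation F hF X
  obtain ⟨r', hr'⟩ := hJ (hullι E' (F.obj X)) (F.map (hullι E X)) (hullι_inflation E' _)
  obtain ⟨k', hk'⟩ := exists_desc (E := E') (r' ≫ F.map (cosyzπ E X)) (by
    rw [reassoc_of% hr', ← F.map_comp, hullι_cosyzπ, F.map_zero])
  exact (cosyzIso h (hull_conflation E' (F.obj X)) hJ (hull_isInj E' _)
    (map_hullι_hullComparison F hF X) hr' (map_cosyzπ_cosyzComparison F hF X) hk').isIso_hom

/-- The induced functor on stable categories commutes with the suspensions. -/
noncomputable def stableFunctorSuspensionIso :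
    suspension E ⋙ stableFunctor F hF ≅ stableFunctor F hF ⋙ suspension E' :=
  CategoryTheory.Quotient.natIsoLift _ (NatIso.ofComponents
    (fun X => haveI := isIso_toStable_map_cosyzComparison F hF X
      show (toStable E').obj (F.obj (cosyz E X)) ≅ (toStable E').obj (cosyz E' (F.obj X)) from
        asIso ((toStable E').map (cosyzComparison F hF X)))
    (fun {X Y} f => by
      obtain ⟨b, hb⟩ := exists_isCosyzMap E f
      obtain ⟨b', hb'⟩ := exists_isCosyzMap E' (F.map f)
      change (stableFunctor F hF).map ((suspension E).map ((toStable E).map f)) ≫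
        (toStable E').map _ = (toStable E').map _ ≫
          (suspension E').map ((toStable E').map (F.map f))
      rw [suspension_map_eq hb, suspension_map_eq hb']
      refine ((toStable E').map_comp (F.map b) (cosyzComparison F hF Y)).symm.trans
        (Eq.trans ?_ ((toStable E').map_comp (cosyzComparison F hF X) b'))
      obtain ⟨a, ha, hab⟩ := hb
      obtain ⟨a', ha', hab'⟩ := hb'
      have h := map_hull_conflation F hF X
      have h₁ := map_hullι_hullComparison F hF X
      have h₂ := map_hullι_hullComparison F hF Y
      have h₃ := map_cosyzπ_cosyzComparison F hF X
      have h₄ := map_cosyzπ_cosyzComparison F hF Y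
      have : Epi (F.map (cosyzπ E X)) :=
        (IsFrobenius.exact (E := E')).epi_of_deflation ⟨_, _, _, h⟩
      obtain ⟨s, hs⟩ := (IsFrobenius.exact (E := E')).exists_desc h
        (F.map a ≫ hullComparison F hF Y - hullComparison F hF X ≫ a') (by
          rw [Preadditive.comp_sub, ← F.map_comp_assoc, ha, F.map_comp_assoc, h₂,
            reassoc_of% h₁, ha', sub_self])
      refine toStable_map_eq_of_factor (hull_isInj E' (F.obj Y)) s (cosyzπ E' (F.obj Y)) ?_
      rw [← cancel_epi (F.map (cosyzπ E X)), Preadditive.comp_add, reassoc_of% hs, reassoc_of% h₃,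
        ← F.map_comp_assoc, ← hab, F.map_comp_assoc, h₄, ← hab', Preadditive.sub_comp,
        Category.assoc, Category.assoc]
      abel))

variable {F}

/-- The induced functor on stable categories preserves distinguished triangles. -/
lemma IsHappelTriangle.map {X Y Z : StableCategory E} {f : X ⟶ Y} {g : Y ⟶ Z}
    {h : Z ⟶ (suspension E).obj X} (H : IsHappelTriangle E f g h) :
    IsHappelTriangle E' ((stableFunctor F hF).map f) ((stableFunctor F hF).map g)
      ((stableFunctor F hF).map h ≫ (stableFunctorSuspensionIso F hF).hom.app X) := by
  obtain ⟨X', Y', Z', u, v, w, ⟨t, sq, hv, ht⟩, a, b, c, h₁, h₂, h₃⟩ := H.exists_iso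
  let G := stableFunctor F hF
  have hw : F.map t ≫ F.map w ≫ cosyzComparison F hF X' =
      hullComparison F hF X' ≫ cosyzπ E' (F.obj X') := by
    rw [← F.map_comp_assoc, ht, map_cosyzπ_cosyzComparison]
  have hw' : F.map v ≫ F.map w ≫ cosyzComparison F hF X' = 0 := by
    rw [← F.map_comp_assoc, hv, F.map_zero, zero_comp]
  have H' := isHappelTriangle_of_isPushout (sq.map F)
    ((isInj_map_iff hF (IsFrobenius.exact (E := E'))).2 (hull_isInj E X'))
    (hullComparison F hF X') (map_hullι_hullComparison F hF X') _ hw' hw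
  refine H'.of_iso (G.mapIso a) (G.mapIso b) (G.mapIso c) ?_ ?_ ?_
  · have := congrArg G.map h₁
    rwa [G.map_comp, G.map_comp] at this
  · have := congrArg G.map h₂
    rwa [G.map_comp, G.map_comp] at this
  · have h₄ : connecting (F.map w ≫ cosyzComparison F hF X') = G.map (connecting w) ≫
        (stableFunctorSuspensionIso F hF).hom.app ((toStable E).obj X') :=
      (toStable E').map_comp _ _
    have h₅ := (stableFunctorSuspensionIso F hF).hom.naturality a.hom
    have h₆ := congrArg G.map h₃
    rw [G.map_comp, G.map_comp] at h₆
    rw [h₄, Category.assoc]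
    refine (congrArg _ h₅.symm).trans ?_
    change G.map (connecting w) ≫ G.map ((suspension E).map a.hom) ≫ _ = G.map c.hom ≫ G.map h ≫ _
    rw [reassoc_of% h₆]

omit hF [F.Additive] [F.IsEquivalence] [IsFrobenius E] [IsFrobenius E']

/-- A shift by `ℤ` is additive if it is additive at `1`. -/
lemma shiftFunctor_additive_of_one [HasShift C ℤ] [(shiftFunctor C (1 : ℤ)).Additive] (n : ℤ) :
    (shiftFunctor C n).Additive := by
  induction n using Int.induction_on with
  | zero => exact Functor.additive_of_iso (shiftFunctorZero C ℤ).symm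
  | succ n ih => exact Functor.additive_of_iso (shiftFunctorAdd C (n : ℤ) 1).symm
  | pred n ih =>
    have := Functor.additive_of_iso (shiftFunctorAdd' C (-(n : ℤ) - 1) 1 (-n) (by omega))
    exact Functor.additive_of_comp_faithful _ (shiftFunctor C (1 : ℤ))

variable [IsFrobenius E] [IsFrobenius E'] [F.Additive] [F.IsEquivalence]

/-- An equivalence that matches the conflations of two Frobenius categories induces a triangle
equivalence of the stable categories. -/
lemma exists_triangle_equivalence (hF : ∀ X : ShortComplex C, E X ↔ E' (X.map F)) :
    ∃ (_ : StableTriangulation E) (_ : StableTriangulation E')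
      (G : StableCategory E ⥤ StableCategory E'),
      toStable E ⋙ G = F ⋙ toStable E' ∧ G.IsEquivalence ∧
      ∃ _ : G.CommShift ℤ, G.IsTriangulated := by
  obtain ⟨hS', ⟨φ'⟩⟩ := exists_shift_of_isEquivalence (suspension E')
  have : (shiftFunctor (StableCategory E') (1 : ℤ)).Additive := Functor.additive_of_iso φ'.symm
  have hA' : ∀ n : ℤ, (shiftFunctor (StableCategory E') n).Additive := shiftFunctor_additive_of_one
  let T' : StableTriangulation E' := stableTriangulationOfShift E' φ'
  let G := stableFunctor F hF
  have hG : G.IsEquivalence := stableFunctor_isEquivalence F hF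
  have hGa : G.Additive := stableFunctor_additive F hF
  -- The shift of the source is transported from the target, so that `G` commutes with it.
  let hG' := Functor.FullyFaithful.ofFullyFaithful G
  let s : ℤ → StableCategory E ⥤ StableCategory E :=
    fun n => G ⋙ shiftFunctor (StableCategory E') n ⋙ G.inv
  let i : ∀ n, s n ⋙ G ≅ G ⋙ shiftFunctor (StableCategory E') n := fun n =>
    Functor.isoWhiskerLeft (G ⋙ shiftFunctor (StableCategory E') n) G.asEquivalence.counitIso
  let hS : HasShift (StableCategory E) ℤ := hG'.hasShift s i
  let hC : G.CommShift ℤ := Functor.CommShift.ofHasShiftOfFullyFaithful hG' s i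
  have hA : ∀ n : ℤ, (shiftFunctor (StableCategory E) n).Additive := fun n => by
    have := Functor.additive_of_iso (G.commShiftIso n).symm
    exact Functor.additive_of_comp_faithful _ G
  let ψ : shiftFunctor (StableCategory E) (1 : ℤ) ⋙ G ≅ suspension E ⋙ G :=
    G.commShiftIso 1 ≪≫ Functor.isoWhiskerLeft G φ' ≪≫ (stableFunctorSuspensionIso F hF).symm
  let φ : shiftFunctor (StableCategory E) (1 : ℤ) ≅ suspension E :=
    (hG'.whiskeringRight _).preimageIso ψ
  have hφ : ∀ X, G.map (φ.hom.app X) = ψ.hom.app X := fun X =>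
    congrArg (fun τ => τ.app X) ((hG'.whiskeringRight _).map_preimage ψ.hom)
  let T : StableTriangulation E := stableTriangulationOfShift E φ
  refine ⟨T, T', G, rfl, hG, hC, ⟨fun X hX => ?_⟩⟩
  have H := IsHappelTriangle.map hF ((T.distinguished_iff X).1 hX)
  refine (T'.distinguished_iff _).2 ?_
  have h₁ : G.map (X.mor₃ ≫ φ.hom.app X.obj₁) ≫
      (stableFunctorSuspensionIso F hF).hom.app X.obj₁ =
        (G.map X.mor₃ ≫ (G.commShiftIso (1 : ℤ)).hom.app X.obj₁) ≫ φ'.hom.app (G.obj X.obj₁) := by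
    rw [G.map_comp, hφ]
    simp [ψ, G]
  change IsHappelTriangle E' _ _ (G.map (X.mor₃ ≫ φ.hom.app X.obj₁) ≫ _) at H
  rw [h₁] at H
  exact H

end Transfer

end ExactFrobenius

namespace MonMF

section Modules

variable {S : Type u} [CommRing S]

/-! ### Gorenstein projective modules -/

/-- Injective homomorphisms `A ⟶ B` along which every linear form on `A` extends to `B`. Between
Gorenstein projective modules these are the monomorphisms with Gorenstein projective cokernel. -/
def IsAdmissibleMono {A B : ModuleCat.{u} S} (f : A ⟶ B) : Prop :=
  Function.Injective f.hom ∧ ∀ h : Module.Dual S A, ∃ h' : Module.Dual S B, h' ∘ₗ f.hom = h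

lemma IsAdmissibleMono.id (A : ModuleCat.{u} S) : IsAdmissibleMono (𝟙 A) :=
  ⟨Function.injective_id, fun h => ⟨h, rfl⟩⟩

lemma IsAdmissibleMono.comp {A B C : ModuleCat.{u} S} {f : A ⟶ B} {g : B ⟶ C}
    (hf : IsAdmissibleMono f) (hg : IsAdmissibleMono g) : IsAdmissibleMono (f ≫ g) := by
  refine ⟨hg.1.comp hf.1, fun h => ?_⟩
  obtain ⟨h₁, rfl⟩ := hf.2 h
  obtain ⟨h₂, rfl⟩ := hg.2 h₁
  exact ⟨h₂, rfl⟩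

lemma IsAdmissibleMono.of_comp {A B C : ModuleCat.{u} S} {f : A ⟶ B} {g : B ⟶ C}
    (h : IsAdmissibleMono (f ≫ g)) : IsAdmissibleMono f := by
  refine ⟨fun x y hxy => h.1 (congrArg g.hom hxy), fun k => ?_⟩
  obtain ⟨k', rfl⟩ := h.2 k
  exact ⟨k' ∘ₗ g.hom, rfl⟩

/-- Maps into finite free modules extend along admissible monomorphisms. -/
lemma IsAdmissibleMono.exists_extension {A B : ModuleCat.{u} S} {f : A ⟶ B}
    (hf : IsAdmissibleMono f) {n : ℕ} (h : A ⟶ ModuleCat.of S (Fin n → S)) :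
    ∃ h' : B ⟶ ModuleCat.of S (Fin n → S), f ≫ h' = h := by
  choose k hk using fun i : Fin n => hf.2 (LinearMap.proj i ∘ₗ h.hom)
  refine ⟨ModuleCat.ofHom (LinearMap.pi k), ?_⟩
  ext x i
  exact congrArg (fun l => l x) (hk i)

/-- A sequence that is short exact on underlying modules is a short exact sequence. -/
lemma shortExact_mk {A B C : ModuleCat.{u} S} {f : A ⟶ B} {g : B ⟶ C}
    (hf : Function.Injective f.hom) (he : Function.Exact f.hom g.hom)
    (hg : Function.Surjective g.hom) :
    (ShortComplex.mk f g (ModuleCat.hom_ext (LinearMap.ext he.apply_apply_eq_zero))).ShortExact where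
  exact := (ShortComplex.ShortExact.moduleCat_exact_iff_function_exact _).2 he
  mono_f := (ModuleCat.mono_iff_injective _).2 hf
  epi_g := (ModuleCat.epi_iff_surjective _).2 hg

lemma ext_subsingleton_of_retract {M N Y : ModuleCat.{u} S} (i : N ⟶ M) (r : M ⟶ N)
    (h : i ≫ r = 𝟙 N) (n : ℕ) [Subsingleton (Abelian.Ext M Y n)] :
    Subsingleton (Abelian.Ext N Y n) := by
  refine subsingleton_of_forall_eq 0 fun x => ?_
  rw [← Abelian.Ext.mk₀_id_comp x, ← h, ← Abelian.Ext.mk₀_comp_mk₀_assoc,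
    Subsingleton.elim ((Abelian.Ext.mk₀ r).comp x (zero_add n)) 0, Abelian.Ext.comp_zero]

lemma ext_subsingleton_biprod {M N Y : ModuleCat.{u} S} (n : ℕ)
    [Subsingleton (Abelian.Ext M Y n)] [Subsingleton (Abelian.Ext N Y n)] :
    Subsingleton (Abelian.Ext (M ⊞ N) Y n) :=
  subsingleton_of_forall_eq 0 fun _ =>
    Abelian.Ext.biprod_ext (Subsingleton.elim _ _) (Subsingleton.elim _ _)

/-- If `Ext¹(C, S) = 0`, then linear forms extend along a monomorphism with cokernel `C`. -/
lemma isAdmissibleMono_of_ext {A B C : ModuleCat.{u} S} {f : A ⟶ B} {g : B ⟶ C}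
    (hf : Function.Injective f.hom) (he : Function.Exact f.hom g.hom)
    (hg : Function.Surjective g.hom) [Subsingleton (Abelian.Ext C (ModuleCat.of S S) 1)] :
    IsAdmissibleMono f := by
  refine ⟨hf, fun h => ?_⟩
  obtain ⟨x, hx⟩ := Abelian.Ext.contravariant_sequence_exact₁ (shortExact_mk hf he hg)
    (ModuleCat.of S S) (Abelian.Ext.mk₀ (ModuleCat.ofHom h)) (n₁ := 1) rfl
    (Subsingleton.elim _ _)
  obtain ⟨k, rfl⟩ := (Abelian.Ext.mk₀_bijective _ _).2 x
  rw [Abelian.Ext.mk₀_comp_mk₀] at hx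
  have := (Abelian.Ext.mk₀_bijective _ _).1 hx
  exact ⟨k.hom, congrArg ModuleCat.Hom.hom this⟩

/-- The kernel of a surjection has vanishing higher extension groups if those of the other terms
vanish. -/
lemma ext_kernel_subsingleton {A B C : ModuleCat.{u} S} {f : A ⟶ B} {g : B ⟶ C}
    (hf : Function.Injective f.hom) (he : Function.Exact f.hom g.hom)
    (hg : Function.Surjective g.hom)
    (hB : ∀ i : ℕ, 1 ≤ i → Subsingleton (Abelian.Ext B (ModuleCat.of S S) i))
    (hC : ∀ i : ℕ, 1 ≤ i → Subsingleton (Abelian.Ext C (ModuleCat.of S S) i)) (i : ℕ) (hi : 1 ≤ i) :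
    Subsingleton (Abelian.Ext A (ModuleCat.of S S) i) := by
  refine subsingleton_of_forall_eq 0 fun x => ?_
  have := hC (i + 1) (by omega)
  have := hB i hi
  obtain ⟨y, rfl⟩ := Abelian.Ext.contravariant_sequence_exact₁ (shortExact_mk hf he hg)
    (ModuleCat.of S S) x (n₁ := i + 1) (add_comm _ _) (Subsingleton.elim _ _)
  rw [Subsingleton.elim y 0, Abelian.Ext.comp_zero]

/-- The cokernel of an admissible monomorphism has vanishing higher extension groups if those of
the other terms vanish. -/
lemma ext_cokernel_subsingleton {A B C : ModuleCat.{u} S} {f : A ⟶ B} {g : B ⟶ C}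
    (hf : IsAdmissibleMono f) (he : Function.Exact f.hom g.hom)
    (hg : Function.Surjective g.hom)
    (hA : ∀ i : ℕ, 1 ≤ i → Subsingleton (Abelian.Ext A (ModuleCat.of S S) i))
    (hB : ∀ i : ℕ, 1 ≤ i → Subsingleton (Abelian.Ext B (ModuleCat.of S S) i)) (i : ℕ) (hi : 1 ≤ i) :
    Subsingleton (Abelian.Ext C (ModuleCat.of S S) i) := by
  refine subsingleton_of_forall_eq 0 fun x => ?_
  have := hB i hi
  obtain ⟨j, rfl⟩ := Nat.exists_eq_add_of_le hi
  obtain ⟨y, rfl⟩ := Abelian.Ext.contravariant_sequence_exact₃ (shortExact_mk hf.1 he hg)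
    (ModuleCat.of S S) x (Subsingleton.elim _ _) (n₀ := j) rfl
  rcases Nat.eq_zero_or_pos j with rfl | hj
  · obtain ⟨k, rfl⟩ := (Abelian.Ext.mk₀_bijective _ _).2 y
    obtain ⟨k', hk'⟩ := hf.2 k.hom
    have hk : k = f ≫ ModuleCat.ofHom k' := ModuleCat.hom_ext hk'.symm
    rw [hk, ← Abelian.Ext.mk₀_comp_mk₀]
    exact (shortExact_mk hf.1 he hg).extClass_comp_assoc _
  · have := hA j hj
    rw [Subsingleton.elim y 0, Abelian.Ext.comp_zero]

/-- The dual of a homomorphism. -/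
abbrev dualMap {A B : ModuleCat.{u} S} (f : A ⟶ B) :
    ModuleCat.of S (Module.Dual S B) ⟶ ModuleCat.of S (Module.Dual S A) :=
  ModuleCat.ofHom f.hom.dualMap

lemma dualMap_injective {B C : ModuleCat.{u} S} {g : B ⟶ C} (hg : Function.Surjective g.hom) :
    Function.Injective (dualMap g).hom :=
  LinearMap.dualMap_injective_of_surjective hg

lemma dualMap_exact {A B C : ModuleCat.{u} S} {f : A ⟶ B} {g : B ⟶ C}
    (he : Function.Exact f.hom g.hom) (hg : Function.Surjective g.hom) :
    Function.Exact (dualMap g).hom (dualMap f).hom := by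
  intro φ
  constructor
  · intro h
    have hker : LinearMap.ker g.hom ≤ LinearMap.ker φ := by
      intro y hy
      obtain ⟨x, rfl⟩ := (he y).1 hy
      exact congrArg (fun k => k x) h
    refine ⟨(Submodule.liftQ _ φ hker) ∘ₗ (g.hom.quotKerEquivOfSurjective hg).symm.toLinearMap, ?_⟩
    ext y
    have : (g.hom.quotKerEquivOfSurjective hg).symm (g.hom y) = Submodule.Quotient.mk y := by
      rw [LinearEquiv.symm_apply_eq]
      rfl
    change Submodule.liftQ _ φ hker ((g.hom.quotKerEquivOfSurjective hg).symm (g.hom y)) = φ y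
    rw [this]
    rfl
  · rintro ⟨ψ, rfl⟩
    ext x
    change ψ (g.hom (f.hom x)) = 0
    rw [he.apply_apply_eq_zero, map_zero]

lemma IsAdmissibleMono.dualMap_surjective {A B : ModuleCat.{u} S} {f : A ⟶ B}
    (hf : IsAdmissibleMono f) : Function.Surjective (dualMap f).hom := hf.2

namespace IsGorensteinProjective

lemma of_iso {M N : ModuleCat.{u} S} (e : M ≅ N) (h : IsGorensteinProjective M) :
    IsGorensteinProjective N := by
  have hfin := h.finite
  have hrefl : Module.IsReflexive S M := ⟨h.reflexive⟩
  have hrefl' : Module.IsReflexive S N := Module.equiv e.toLinearEquiv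
  refine ⟨Module.Finite.equiv e.toLinearEquiv, fun i hi => ?_, fun i hi => ?_, ?_⟩
  · have := h.ext_eq_zero i hi
    exact ext_subsingleton_of_retract e.inv e.hom e.inv_hom_id i
  · have := h.ext_dual_eq_zero i hi
    refine ext_subsingleton_of_retract (dualMap e.hom) (dualMap e.inv) ?_ i
    ext φ x
    change φ ((e.inv ≫ e.hom).hom x) = φ x
    rw [e.inv_hom_id]
    rfl
  · exact Module.bijective_dual_eval S N

lemma smul_injective {M : ModuleCat.{u} S} (h : IsGorensteinProjective M) {ω : S}
    (hω : ω ∈ nonZeroDivisors S) {x : M} (hx : ω • x = 0) : x = 0 := by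
  apply h.reflexive.1
  ext φ
  have : φ x * ω = 0 := by
    rw [mul_comm, ← smul_eq_mul, ← map_smul, hx, map_zero]
  simpa using (mul_right_mem_nonZeroDivisors_eq_zero_iff hω).1 this

lemma of_free (n : ℕ) : IsGorensteinProjective (ModuleCat.of S (Fin n → S)) := by
  have : Projective (ModuleCat.of S (Fin n → S)) :=
    (IsProjective.iff_projective _).1 inferInstance
  have : Projective (ModuleCat.of S (Module.Dual S (Fin n → S))) :=
    (IsProjective.iff_projective _).1 inferInstance
  refine ⟨inferInstanceAs (Module.Finite S (Fin n → S)), fun i hi => ?_, fun i hi => ?_,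
    Module.bijective_dual_eval S _⟩
  · obtain ⟨j, rfl⟩ := Nat.exists_eq_add_of_le' hi
    exact subsingleton_of_forall_eq 0 Abelian.Ext.eq_zero_of_projective
  · obtain ⟨j, rfl⟩ := Nat.exists_eq_add_of_le' hi
    exact subsingleton_of_forall_eq 0 Abelian.Ext.eq_zero_of_projective

lemma biprod {M N : ModuleCat.{u} S} (hM : IsGorensteinProjective M)
    (hN : IsGorensteinProjective N) : IsGorensteinProjective (M ⊞ N) := by
  have := hM.finite
  have := hN.finite
  have : Module.IsReflexive S M := ⟨hM.reflexive⟩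
  have : Module.IsReflexive S N := ⟨hN.reflexive⟩
  let e : (M × N) ≃ₗ[S] (M ⊞ N : ModuleCat.{u} S) :=
    (ModuleCat.biprodIsoProd M N).toLinearEquiv.symm
  have hrefl : Module.IsReflexive S (M ⊞ N : ModuleCat.{u} S) := Module.equiv e
  refine ⟨Module.Finite.equiv e, fun i hi => ?_, fun i hi => ?_,
    Module.bijective_dual_eval S _⟩
  · have := hM.ext_eq_zero i hi
    have := hN.ext_eq_zero i hi
    exact ext_subsingleton_biprod i
  · have := hM.ext_dual_eq_zero i hi
    have := hN.ext_dual_eq_zero i hi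
    have := ext_subsingleton_biprod (M := ModuleCat.of S (Module.Dual S M))
      (N := ModuleCat.of S (Module.Dual S N)) (Y := ModuleCat.of S S) i
    refine ext_subsingleton_of_retract
      (biprod.lift (dualMap (biprod.inl : M ⟶ M ⊞ N)) (dualMap (biprod.inr : N ⟶ M ⊞ N)))
      (biprod.desc (dualMap (biprod.fst : M ⊞ N ⟶ M)) (dualMap (biprod.snd : M ⊞ N ⟶ N))) ?_ i
    rw [biprod.lift_desc]
    ext φ x
    have hx := congrArg (fun f => φ (f.hom x)) (biprod.total (X := M) (Y := N))
    exact (map_add φ _ _).symm.trans hx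

lemma finite_dual [IsNoetherianRing S] {M : ModuleCat.{u} S} (h : IsGorensteinProjective M) :
    Module.Finite S (Module.Dual S M) := by
  have := h.finite
  obtain ⟨n, f, hf⟩ := Module.Finite.exists_fin' S M
  have : Module.Finite S (Module.Dual S (Fin n → S)) :=
    Module.Finite.equiv (Pi.basisFun S (Fin n)).toDualEquiv
  exact Module.Finite.of_injective f.dualMap (LinearMap.dualMap_injective_of_surjective hf)

lemma dual [IsNoetherianRing S] {M : ModuleCat.{u} S} (h : IsGorensteinProjective M) :
    IsGorensteinProjective (ModuleCat.of S (Module.Dual S M)) := by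
  have hr : Module.IsReflexive S M := ⟨h.reflexive⟩
  refine ⟨h.finite_dual, h.ext_dual_eq_zero, fun i hi => ?_,
    Module.bijective_dual_eval S _⟩
  have := h.ext_eq_zero i hi
  let e : M ≅ ModuleCat.of S (Module.Dual S (Module.Dual S M)) :=
    (Module.evalEquiv S M).toModuleIso
  exact ext_subsingleton_of_retract e.inv e.hom e.inv_hom_id i

/-- Kernels of surjections between Gorenstein projective modules are Gorenstein projective. -/
lemma kernel [IsNoetherianRing S] {A B C : ModuleCat.{u} S} {f : A ⟶ B} {g : B ⟶ C}
    (hf : Function.Injective f.hom) (he : Function.Exact f.hom g.hom)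
    (hg : Function.Surjective g.hom) (hB : IsGorensteinProjective B)
    (hC : IsGorensteinProjective C) : IsGorensteinProjective A := by
  have := hB.finite
  have := hC.ext_eq_zero 1 le_rfl
  have hadm : IsAdmissibleMono f := isAdmissibleMono_of_ext hf he hg
  refine ⟨Module.Finite.of_injective f.hom hf,
    ext_kernel_subsingleton hf he hg hB.ext_eq_zero hC.ext_eq_zero,
    ext_cokernel_subsingleton (f := dualMap g) (g := dualMap f) ⟨dualMap_injective hg, ?_⟩
      (dualMap_exact he hg) hadm.dualMap_surjective hC.ext_dual_eq_zero hB.ext_dual_eq_zero, ?_, ?_⟩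
  · -- Linear forms on the dual of `C` are evaluations, which lift along `g`.
    intro ξ
    obtain ⟨z, rfl⟩ := hC.reflexive.2 ξ
    obtain ⟨y, rfl⟩ := hg z
    exact ⟨Module.Dual.eval S B y, rfl⟩
  · rw [injective_iff_map_eq_zero]
    intro x hx
    apply hf
    rw [map_zero]
    apply hB.reflexive.1
    rw [map_zero]
    ext φ
    exact congrArg (fun k => k (φ ∘ₗ f.hom)) hx
  · intro ξ
    obtain ⟨y, hy⟩ := hB.reflexive.2 (ξ ∘ₗ f.hom.dualMap)
    have hy' : ∀ φ : Module.Dual S B, φ y = ξ (φ ∘ₗ f.hom) := fun φ => congrArg (fun k => k φ) hy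
    obtain ⟨x, rfl⟩ := (he y).1 (hC.reflexive.1 (by
      rw [map_zero]
      ext ψ
      refine (hy' (ψ ∘ₗ g.hom)).trans ?_
      have : (ψ ∘ₗ g.hom) ∘ₗ f.hom = 0 := by
        ext x
        change ψ (g.hom (f.hom x)) = 0
        rw [he.apply_apply_eq_zero, map_zero]
      rw [this, map_zero]
      rfl))
    refine ⟨x, ?_⟩
    ext φ
    obtain ⟨φ', rfl⟩ := hadm.2 φ
    exact hy' φ'

/-- Cokernels of admissible monomorphisms between Gorenstein projective modules are Gorenstein
projective: by duality they are kernels of surjections. -/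
lemma cokernel [IsNoetherianRing S] {A B C : ModuleCat.{u} S} {f : A ⟶ B} {g : B ⟶ C}
    (hf : IsAdmissibleMono f) (he : Function.Exact f.hom g.hom)
    (hg : Function.Surjective g.hom) (hA : IsGorensteinProjective A)
    (hB : IsGorensteinProjective B) : IsGorensteinProjective C := by
  have hCd : IsGorensteinProjective (ModuleCat.of S (Module.Dual S C)) :=
    kernel (dualMap_injective hg) (dualMap_exact he hg) hf.dualMap_surjective hB.dual hA.dual
  have := hA.ext_dual_eq_zero 1 le_rfl
  have hadm : IsAdmissibleMono (dualMap g) :=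
    isAdmissibleMono_of_ext (dualMap_injective hg) (dualMap_exact he hg) hf.dualMap_surjective
  have hbij : Function.Bijective (Module.Dual.eval S C) := by
    constructor
    · rw [injective_iff_map_eq_zero]
      intro z hz
      obtain ⟨y, rfl⟩ := hg z
      obtain ⟨η, hη⟩ := (dualMap_exact (dualMap_exact he hg) hf.dualMap_surjective
        (Module.Dual.eval S B y)).1 (by
          ext ψ
          exact congrArg (fun k => k ψ) hz)
      obtain ⟨x, rfl⟩ := hA.reflexive.2 η
      have hy : f.hom x = y := hB.reflexive.1 hη
      rw [← hy, he.apply_apply_eq_zero]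
    · intro ξ
      obtain ⟨ξ', rfl⟩ := hadm.2 ξ
      obtain ⟨y, rfl⟩ := hB.reflexive.2 ξ'
      exact ⟨g.hom y, rfl⟩
  exact of_iso (LinearEquiv.ofBijective (Module.Dual.eval S C) hbij).symm.toModuleIso hCd.dual

/-- Every Gorenstein projective module embeds admissibly into a finite free module: take
generators of the dual as coordinates. -/
lemma exists_isAdmissibleMono [IsNoetherianRing S] {M : ModuleCat.{u} S}
    (h : IsGorensteinProjective M) :
    ∃ (n : ℕ) (f : M ⟶ ModuleCat.of S (Fin n → S)), IsAdmissibleMono f := by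
  have := h.finite_dual
  obtain ⟨n, s, hs⟩ := Module.Finite.exists_fin (R := S) (M := Module.Dual S M)
  have hmem : ∀ φ : Module.Dual S M, ∃ c : Fin n → S, ∑ i, c i • s i = φ := fun φ =>
    (Submodule.mem_span_range_iff_exists_fun S).1 (hs ▸ Submodule.mem_top)
  refine ⟨n, ModuleCat.ofHom (LinearMap.pi s), ?_, fun φ => ?_⟩
  · rw [injective_iff_map_eq_zero]
    intro x hx
    apply h.reflexive.1
    rw [map_zero]
    ext φ
    obtain ⟨c, rfl⟩ := hmem φ
    have hx' : ∀ i, s i x = 0 := fun i => congrFun hx i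
    simp [hx']
  · obtain ⟨c, rfl⟩ := hmem φ
    refine ⟨∑ i, c i • LinearMap.proj i, ?_⟩
    ext x
    simp

lemma exists_surjective {M : ModuleCat.{u} S} (h : IsGorensteinProjective M) :
    ∃ (n : ℕ) (f : ModuleCat.of S (Fin n → S) ⟶ M), Function.Surjective f.hom := by
  have := h.finite
  obtain ⟨n, f, hf⟩ := Module.Finite.exists_fin' S M
  exact ⟨n, ModuleCat.ofHom f, hf⟩

end IsGorensteinProjective

end Modules

end MonMF

namespace MonMF

section Modules

variable {S : Type u} [CommRing S]

lemma exact_kernel_ι {B Z : ModuleCat.{u} S} (p : B ⟶ Z) :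
    Function.Exact (kernel.ι p).hom p.hom :=
  (ShortComplex.ShortExact.moduleCat_exact_iff_function_exact _).1 (ShortComplex.exact_kernel p)

lemma exact_cokernel_π {A B : ModuleCat.{u} S} (i : A ⟶ B) :
    Function.Exact i.hom (cokernel.π i).hom :=
  (ShortComplex.ShortExact.moduleCat_exact_iff_function_exact _).1 (ShortComplex.exact_cokernel i)

lemma IsGorensteinProjective.of_kernel [IsNoetherianRing S] {B Z : ModuleCat.{u} S} {p : B ⟶ Z}
    (hp : Function.Surjective p.hom) (hB : IsGorensteinProjective B)
    (hZ : IsGorensteinProjective Z) : IsGorensteinProjective (Limits.kernel p) :=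
  kernel ((ModuleCat.mono_iff_injective _).1 inferInstance) (exact_kernel_ι p) hp hB hZ

lemma IsGorensteinProjective.of_cokernel [IsNoetherianRing S] {A B : ModuleCat.{u} S} {i : A ⟶ B}
    (hi : IsAdmissibleMono i) (hA : IsGorensteinProjective A)
    (hB : IsGorensteinProjective B) : IsGorensteinProjective (Limits.cokernel i) :=
  cokernel hi (exact_cokernel_π i) ((ModuleCat.epi_iff_surjective _).1 inferInstance) hA hB

/-- Admissible monomorphisms are stable under push-out. -/
lemma IsAdmissibleMono.of_isPushout {A B A' P : ModuleCat.{u} S} {i : A ⟶ B} {f : A ⟶ A'}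
    {f' : B ⟶ P} {i' : A' ⟶ P} (sq : IsPushout i f f' i') (hi : IsAdmissibleMono i) :
    IsAdmissibleMono i' := by
  have : Mono i := (ModuleCat.mono_iff_injective _).2 hi.1
  have : Mono i' := (MorphismProperty.monomorphisms _).of_isPushout sq.flip this
  refine ⟨(ModuleCat.mono_iff_injective _).1 this, fun h => ?_⟩
  obtain ⟨k, hk⟩ := hi.2 (h ∘ₗ f.hom)
  refine ⟨(sq.desc (ModuleCat.ofHom k) (ModuleCat.ofHom h) (ModuleCat.hom_ext hk)).hom, ?_⟩
  exact congrArg ModuleCat.Hom.hom (sq.inr_desc _ _ _)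

/-- A push-out of Gorenstein projective modules along an admissible monomorphism `i : A ⟶ B` is
the cokernel of an admissible monomorphism from `A` to a direct sum. -/
lemma IsGorensteinProjective.of_isPushout [IsNoetherianRing S] {A B A' P : ModuleCat.{u} S}
    {i : A ⟶ B} {f : A ⟶ A'} {f' : B ⟶ P} {i' : A' ⟶ P} (sq : IsPushout i f f' i')
    (hi : IsAdmissibleMono i) (hA : IsGorensteinProjective A) (hB : IsGorensteinProjective B)
    (hA' : IsGorensteinProjective A') : IsGorensteinProjective P := by
  have := sq.epi_shortComplex_g
  refine cokernel (f := sq.shortComplex.f) (g := sq.shortComplex.g)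
    (IsAdmissibleMono.of_comp (g := biprod.fst) ?_)
    ((ShortComplex.ShortExact.moduleCat_exact_iff_function_exact _).1 sq.exact_shortComplex)
    ((ModuleCat.epi_iff_surjective _).1 this) hA (biprod hB hA')
  exact (biprod.lift_fst i (-f)).symm ▸ hi

lemma IsGorensteinProjective.of_isPullback [IsNoetherianRing S] {B Z Z' P : ModuleCat.{u} S}
    {p : B ⟶ Z} {f : Z' ⟶ Z} {f' : P ⟶ B} {p' : P ⟶ Z'} (sq : IsPullback f' p' p f)
    (hp : Function.Surjective p.hom) (hB : IsGorensteinProjective B)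
    (hZ : IsGorensteinProjective Z) (hZ' : IsGorensteinProjective Z') :
    IsGorensteinProjective P := by
  have hm := sq.mono_shortComplex'_f
  have : Epi p := (ModuleCat.epi_iff_surjective _).2 hp
  have : Epi (biprod.inl ≫ sq.shortComplex'.g) := (biprod.inl_desc p (-f)).symm ▸ this
  refine kernel (f := sq.shortComplex'.f) (g := sq.shortComplex'.g)
    ((ModuleCat.mono_iff_injective _).1 hm)
    ((ShortComplex.ShortExact.moduleCat_exact_iff_function_exact _).1 sq.exact_shortComplex')
    ((ModuleCat.epi_iff_surjective _).1 (epi_of_epi biprod.inl _)) (biprod hB hZ') hZ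

end Modules

namespace MFG

/-! ### Matrix factorizations -/

variable {S : Type u} [CommRing S] {ω : S}

@[simp] lemma comp_φ₁ {X Y Z : MFG ω} (f : X ⟶ Y) (g : Y ⟶ Z) : (f ≫ g).φ₁ = f.φ₁ ≫ g.φ₁ := rfl
@[simp] lemma comp_φ₀ {X Y Z : MFG ω} (f : X ⟶ Y) (g : Y ⟶ Z) : (f ≫ g).φ₀ = f.φ₀ ≫ g.φ₀ := rfl

attribute [simp] MFG.d₁_d₀ MFG.d₀_d₁

@[simp] lemma d₁_d₀_assoc (X : MFG ω) {M : ModuleCat.{u} S} (h : X.G₁ ⟶ M) :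
    X.d₁ ≫ X.d₀ ≫ h = ω • h := by
  rw [← Category.assoc, X.d₁_d₀, Linear.smul_comp, Category.id_comp]

@[simp] lemma d₀_d₁_assoc (X : MFG ω) {M : ModuleCat.{u} S} (h : X.G₀ ⟶ M) :
    X.d₀ ≫ X.d₁ ≫ h = ω • h := by
  rw [← Category.assoc, X.d₀_d₁, Linear.smul_comp, Category.id_comp]

instance : HasZeroObject (MFG ω) := by
  have hZ : IsZero (ModuleCat.of S (Fin 0 → S)) := ModuleCat.isZero_of_subsingleton _
  refine ⟨⟨_, _, .of_free 0, .of_free 0, 0, 0, hZ.eq_of_src _ _, hZ.eq_of_src _ _⟩,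
    fun Y => ⟨⟨⟨0⟩, fun f => ?_⟩⟩, fun Y => ⟨⟨⟨0⟩, fun f => ?_⟩⟩⟩
  · exact hom_ext (hZ.eq_of_src _ _) (hZ.eq_of_src _ _)
  · exact hom_ext (hZ.eq_of_tgt _ _) (hZ.eq_of_tgt _ _)

/-- The componentwise direct sum of two matrix factorizations. -/
noncomputable def sum (X Y : MFG ω) : MFG ω where
  G₁ := X.G₁ ⊞ Y.G₁
  G₀ := X.G₀ ⊞ Y.G₀
  gorenstein₁ := .biprod X.gorenstein₁ Y.gorenstein₁
  gorenstein₀ := .biprod X.gorenstein₀ Y.gorenstein₀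
  d₁ := biprod.map X.d₁ Y.d₁
  d₀ := biprod.map X.d₀ Y.d₀
  d₁_d₀ := biprod.hom_ext' _ _ (by simp) (by simp)
  d₀_d₁ := biprod.hom_ext' _ _ (by simp) (by simp)

instance : HasBinaryBiproducts (MFG ω) where
  has_binary_biproduct X Y := hasBinaryBiproduct_of_total
    { pt := sum X Y
      fst := ⟨biprod.fst, biprod.fst, biprod.map_fst _ _, biprod.map_fst _ _⟩
      snd := ⟨biprod.snd, biprod.snd, biprod.map_snd _ _, biprod.map_snd _ _⟩
      inl := ⟨biprod.inl, biprod.inl, (biprod.inl_map _ _).symm, (biprod.inl_map _ _).symm⟩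
      inr := ⟨biprod.inr, biprod.inr, (biprod.inr_map _ _).symm, (biprod.inr_map _ _).symm⟩
      inl_fst := hom_ext biprod.inl_fst biprod.inl_fst
      inl_snd := hom_ext biprod.inl_snd biprod.inl_snd
      inr_fst := hom_ext biprod.inr_fst biprod.inr_fst
      inr_snd := hom_ext biprod.inr_snd biprod.inr_snd }
    (hom_ext biprod.total biprod.total)

/-- The first component of a matrix factorization. -/
@[simps] def eval₁ (ω : S) : MFG ω ⥤ ModuleCat.{u} S where
  obj X := X.G₁
  map f := f.φ₁

/-- The second component of a matrix factorization. -/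
@[simps] def eval₀ (ω : S) : MFG ω ⥤ ModuleCat.{u} S where
  obj X := X.G₀
  map f := f.φ₀

instance : (eval₁ ω).PreservesZeroMorphisms where
instance : (eval₀ ω).PreservesZeroMorphisms where

lemma mfConflation_iff (X : ShortComplex (MFG ω)) :
    mfConflation ω X ↔ (X.map (eval₁ ω)).ShortExact ∧ (X.map (eval₀ ω)).ShortExact := by
  constructor
  · rintro ⟨⟨h, h', h''⟩, k, k', k''⟩
    exact ⟨shortExact_mk h h' h'', shortExact_mk k k' k''⟩
  · rintro ⟨h, k⟩
    exact ⟨⟨h.moduleCat_injective_f, (ShortComplex.ShortExact.moduleCat_exact_iff_function_exact _).1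
      h.exact, h.moduleCat_surjective_g⟩, k.moduleCat_injective_f,
      (ShortComplex.ShortExact.moduleCat_exact_iff_function_exact _).1 k.exact,
      k.moduleCat_surjective_g⟩

lemma mfConflation_isClosedUnderIsomorphisms : (mfConflation ω).IsClosedUnderIsomorphisms where
  of_iso e hX := by
    rw [mfConflation_iff] at hX ⊢
    exact ⟨ShortComplex.shortExact_of_iso ((eval₁ ω).mapShortComplex.mapIso e) hX.1,
      ShortComplex.shortExact_of_iso ((eval₀ ω).mapShortComplex.mapIso e) hX.2⟩

/-- Lifts along the first map of a conflation are formed componentwise; they commute with the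
structure maps as the components of that map are monomorphisms. -/
lemma isKernel {X : ShortComplex (MFG ω)} (hX : mfConflation ω X) :
    Nonempty (IsLimit (KernelFork.ofι X.f X.zero)) := by
  have h₁ := shortExact_mk hX.1.1 hX.1.2.1 hX.1.2.2
  have h₀ := shortExact_mk hX.2.1 hX.2.2.1 hX.2.2.2
  have : Mono X.f.φ₁ := h₁.mono_f
  have : Mono X.f.φ₀ := h₀.mono_f
  have : Mono X.f := ⟨fun a b h => hom_ext
    ((cancel_mono X.f.φ₁).1 (congrArg Hom.φ₁ h)) ((cancel_mono X.f.φ₀).1 (congrArg Hom.φ₀ h))⟩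
  refine ⟨KernelFork.IsLimit.ofι' _ _ fun k hk => ⟨⟨h₁.exact.lift k.φ₁ (congrArg Hom.φ₁ hk),
    h₀.exact.lift k.φ₀ (congrArg Hom.φ₀ hk), ?_, ?_⟩,
    hom_ext (h₁.exact.lift_f _ _) (h₀.exact.lift_f _ _)⟩⟩
  · have e₁ := h₁.exact.lift_f k.φ₁ (congrArg Hom.φ₁ hk)
    have e₀ := h₀.exact.lift_f k.φ₀ (congrArg Hom.φ₀ hk)
    dsimp at e₁ e₀
    rw [← cancel_mono X.f.φ₀, Category.assoc, Category.assoc, e₀, X.f.comm₁,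
      reassoc_of% e₁, k.comm₁]
  · have e₁ := h₁.exact.lift_f k.φ₁ (congrArg Hom.φ₁ hk)
    have e₀ := h₀.exact.lift_f k.φ₀ (congrArg Hom.φ₀ hk)
    dsimp at e₁ e₀
    rw [← cancel_mono X.f.φ₁, Category.assoc, Category.assoc, e₁, X.f.comm₀,
      reassoc_of% e₀, k.comm₀]

lemma isCokernel {X : ShortComplex (MFG ω)} (hX : mfConflation ω X) :
    Nonempty (IsColimit (CokernelCofork.ofπ X.g X.zero)) := by
  have h₁ := shortExact_mk hX.1.1 hX.1.2.1 hX.1.2.2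
  have h₀ := shortExact_mk hX.2.1 hX.2.2.1 hX.2.2.2
  have : Epi X.g.φ₁ := h₁.epi_g
  have : Epi X.g.φ₀ := h₀.epi_g
  have : Epi X.g := ⟨fun a b h => hom_ext
    ((cancel_epi X.g.φ₁).1 (congrArg Hom.φ₁ h)) ((cancel_epi X.g.φ₀).1 (congrArg Hom.φ₀ h))⟩
  refine ⟨CokernelCofork.IsColimit.ofπ' _ _ fun k hk =>
    ⟨⟨h₁.exact.desc k.φ₁ (congrArg Hom.φ₁ hk),
    h₀.exact.desc k.φ₀ (congrArg Hom.φ₀ hk), ?_, ?_⟩,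
    hom_ext (h₁.exact.g_desc _ _) (h₀.exact.g_desc _ _)⟩⟩
  · have e₁ := h₁.exact.g_desc k.φ₁ (congrArg Hom.φ₁ hk)
    have e₀ := h₀.exact.g_desc k.φ₀ (congrArg Hom.φ₀ hk)
    dsimp at e₁ e₀
    rw [← cancel_epi X.g.φ₁, ← reassoc_of% X.g.comm₁, e₀, reassoc_of% e₁, k.comm₁]
  · have e₁ := h₁.exact.g_desc k.φ₁ (congrArg Hom.φ₁ hk)
    have e₀ := h₀.exact.g_desc k.φ₀ (congrArg Hom.φ₀ hk)
    dsimp at e₁ e₀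
    rw [← cancel_epi X.g.φ₀, ← reassoc_of% X.g.comm₀, e₁, reassoc_of% e₀, k.comm₀]

variable [IsNoetherianRing S]

/-- The deflations are the componentwise surjective morphisms. -/
lemma deflation_iff {B Z : MFG ω} (p : B ⟶ Z) :
    Deflation (mfConflation ω) p ↔
      Function.Surjective p.φ₁.hom ∧ Function.Surjective p.φ₀.hom := by
  constructor
  · rintro ⟨A, i, w, h⟩
    exact ⟨h.1.2.2, h.2.2.2⟩
  · rintro ⟨h₁, h₀⟩
    let K : MFG ω :=
      { G₁ := kernel p.φ₁
        G₀ := kernel p.φ₀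
        gorenstein₁ := .of_kernel h₁ B.gorenstein₁ Z.gorenstein₁
        gorenstein₀ := .of_kernel h₀ B.gorenstein₀ Z.gorenstein₀
        d₁ := kernel.map _ _ B.d₁ Z.d₁ p.comm₁.symm
        d₀ := kernel.map _ _ B.d₀ Z.d₀ p.comm₀.symm
        d₁_d₀ := by simp [← cancel_mono (kernel.ι p.φ₁)]
        d₀_d₁ := by simp [← cancel_mono (kernel.ι p.φ₀)] }
    exact ⟨K, ⟨kernel.ι _, kernel.ι _, (kernel.lift_ι _ _ _), (kernel.lift_ι _ _ _)⟩,
      hom_ext (kernel.condition _) (kernel.condition _),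
      ⟨(ModuleCat.mono_iff_injective _).1 inferInstance, exact_kernel_ι _, h₁⟩,
      (ModuleCat.mono_iff_injective _).1 inferInstance, exact_kernel_ι _, h₀⟩

/-- The inflations are the componentwise admissible monomorphisms. -/
lemma inflation_iff {A B : MFG ω} (i : A ⟶ B) :
    Inflation (mfConflation ω) i ↔ IsAdmissibleMono i.φ₁ ∧ IsAdmissibleMono i.φ₀ := by
  constructor
  · rintro ⟨Z, p, w, h⟩
    have := Z.gorenstein₁.ext_eq_zero 1 le_rfl
    have := Z.gorenstein₀.ext_eq_zero 1 le_rfl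
    exact ⟨isAdmissibleMono_of_ext h.1.1 h.1.2.1 h.1.2.2,
      isAdmissibleMono_of_ext h.2.1 h.2.2.1 h.2.2.2⟩
  · rintro ⟨h₁, h₀⟩
    let K : MFG ω :=
      { G₁ := cokernel i.φ₁
        G₀ := cokernel i.φ₀
        gorenstein₁ := .of_cokernel h₁ A.gorenstein₁ B.gorenstein₁
        gorenstein₀ := .of_cokernel h₀ A.gorenstein₀ B.gorenstein₀
        d₁ := cokernel.map _ _ A.d₁ B.d₁ i.comm₁.symm
        d₀ := cokernel.map _ _ A.d₀ B.d₀ i.comm₀.symm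
        d₁_d₀ := by simp [← cancel_epi (cokernel.π i.φ₁)]
        d₀_d₁ := by simp [← cancel_epi (cokernel.π i.φ₀)] }
    exact ⟨K, ⟨cokernel.π _, cokernel.π _, (cokernel.π_desc _ _ _).symm,
      (cokernel.π_desc _ _ _).symm⟩,
      hom_ext (cokernel.condition _) (cokernel.condition _),
      ⟨h₁.1, exact_cokernel_π _, (ModuleCat.epi_iff_surjective _).1 inferInstance⟩,
      h₀.1, exact_cokernel_π _, (ModuleCat.epi_iff_surjective _).1 inferInstance⟩

lemma exists_pushout {A B A' : MFG ω} (i : A ⟶ B) (f : A ⟶ A') (hi : Inflation (mfConflation ω) i) :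
    ∃ (B' : MFG ω) (f' : B ⟶ B') (i' : A' ⟶ B'),
      IsPushout i f f' i' ∧ Inflation (mfConflation ω) i' := by
  rw [inflation_iff] at hi
  have sq₁ := IsPushout.of_hasPushout i.φ₁ f.φ₁
  have sq₀ := IsPushout.of_hasPushout i.φ₀ f.φ₀
  let P : MFG ω :=
    { G₁ := pushout i.φ₁ f.φ₁
      G₀ := pushout i.φ₀ f.φ₀
      gorenstein₁ := .of_isPushout sq₁ hi.1 A.gorenstein₁ B.gorenstein₁ A'.gorenstein₁
      gorenstein₀ := .of_isPushout sq₀ hi.2 A.gorenstein₀ B.gorenstein₀ A'.gorenstein₀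
      d₁ := pushout.map _ _ _ _ B.d₁ A'.d₁ A.d₁ i.comm₁.symm f.comm₁.symm
      d₀ := pushout.map _ _ _ _ B.d₀ A'.d₀ A.d₀ i.comm₀.symm f.comm₀.symm
      d₁_d₀ := pushout.hom_ext (by simp [pushout.inl_desc_assoc, pushout.inl_desc])
        (by simp [pushout.inr_desc_assoc, pushout.inr_desc])
      d₀_d₁ := pushout.hom_ext (by simp [pushout.inl_desc_assoc, pushout.inl_desc])
        (by simp [pushout.inr_desc_assoc, pushout.inr_desc]) }
  refine ⟨P, ⟨pushout.inl _ _, pushout.inl _ _, (pushout.inl_desc _ _ _).symm,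
    (pushout.inl_desc _ _ _).symm⟩, ⟨pushout.inr _ _, pushout.inr _ _,
    (pushout.inr_desc _ _ _).symm, (pushout.inr_desc _ _ _).symm⟩,
    ⟨⟨hom_ext sq₁.w sq₀.w⟩, ⟨PushoutCocone.IsColimit.mk _
      (fun s => ⟨pushout.desc s.inl.φ₁ s.inr.φ₁ (congrArg Hom.φ₁ s.condition),
        pushout.desc s.inl.φ₀ s.inr.φ₀ (congrArg Hom.φ₀ s.condition), ?_, ?_⟩)
      (fun s => hom_ext (pushout.inl_desc _ _ _) (pushout.inl_desc _ _ _))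
      (fun s => hom_ext (pushout.inr_desc _ _ _) (pushout.inr_desc _ _ _))
      (fun s m hl hr => hom_ext ?_ ?_)⟩⟩, ?_⟩
  · exact pushout.hom_ext (by simp [P, pushout.inl_desc_assoc, pushout.inl_desc, s.inl.comm₁])
      (by simp [P, pushout.inr_desc_assoc, pushout.inr_desc, s.inr.comm₁])
  · exact pushout.hom_ext (by simp [P, pushout.inl_desc_assoc, pushout.inl_desc, s.inl.comm₀])
      (by simp [P, pushout.inr_desc_assoc, pushout.inr_desc, s.inr.comm₀])
  · exact pushout.hom_ext
      ((congrArg Hom.φ₁ hl).trans (pushout.inl_desc _ _ (congrArg Hom.φ₁ s.condition)).symm)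
      ((congrArg Hom.φ₁ hr).trans (pushout.inr_desc _ _ (congrArg Hom.φ₁ s.condition)).symm)
  · exact pushout.hom_ext
      ((congrArg Hom.φ₀ hl).trans (pushout.inl_desc _ _ (congrArg Hom.φ₀ s.condition)).symm)
      ((congrArg Hom.φ₀ hr).trans (pushout.inr_desc _ _ (congrArg Hom.φ₀ s.condition)).symm)
  · exact (inflation_iff _).2 ⟨hi.1.of_isPushout sq₁, hi.2.of_isPushout sq₀⟩

lemma exists_pullback {B Z Z' : MFG ω} (p : B ⟶ Z) (f : Z' ⟶ Z)
    (hp : Deflation (mfConflation ω) p) :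
    ∃ (B' : MFG ω) (f' : B' ⟶ B) (p' : B' ⟶ Z'),
      IsPullback f' p' p f ∧ Deflation (mfConflation ω) p' := by
  rw [deflation_iff] at hp
  have : Epi p.φ₁ := (ModuleCat.epi_iff_surjective _).2 hp.1
  have : Epi p.φ₀ := (ModuleCat.epi_iff_surjective _).2 hp.2
  have sq₁ := IsPullback.of_hasPullback p.φ₁ f.φ₁
  have sq₀ := IsPullback.of_hasPullback p.φ₀ f.φ₀
  let P : MFG ω :=
    { G₁ := pullback p.φ₁ f.φ₁
      G₀ := pullback p.φ₀ f.φ₀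
      gorenstein₁ := .of_isPullback sq₁ hp.1 B.gorenstein₁ Z.gorenstein₁ Z'.gorenstein₁
      gorenstein₀ := .of_isPullback sq₀ hp.2 B.gorenstein₀ Z.gorenstein₀ Z'.gorenstein₀
      d₁ := pullback.map _ _ _ _ B.d₁ Z'.d₁ Z.d₁ p.comm₁.symm f.comm₁.symm
      d₀ := pullback.map _ _ _ _ B.d₀ Z'.d₀ Z.d₀ p.comm₀.symm f.comm₀.symm
      d₁_d₀ := pullback.hom_ext (by simp [pullback.lift_fst_assoc, pullback.lift_fst])
        (by simp [pullback.lift_snd_assoc, pullback.lift_snd])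
      d₀_d₁ := pullback.hom_ext (by simp [pullback.lift_fst_assoc, pullback.lift_fst])
        (by simp [pullback.lift_snd_assoc, pullback.lift_snd]) }
  refine ⟨P, ⟨pullback.fst _ _, pullback.fst _ _, pullback.lift_fst _ _ _,
    pullback.lift_fst _ _ _⟩, ⟨pullback.snd _ _, pullback.snd _ _,
    pullback.lift_snd _ _ _, pullback.lift_snd _ _ _⟩,
    ⟨⟨hom_ext sq₁.w sq₀.w⟩, ⟨PullbackCone.IsLimit.mk _
      (fun s => ⟨pullback.lift s.fst.φ₁ s.snd.φ₁ (congrArg Hom.φ₁ s.condition),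
        pullback.lift s.fst.φ₀ s.snd.φ₀ (congrArg Hom.φ₀ s.condition), ?_, ?_⟩)
      (fun s => hom_ext (pullback.lift_fst _ _ _) (pullback.lift_fst _ _ _))
      (fun s => hom_ext (pullback.lift_snd _ _ _) (pullback.lift_snd _ _ _))
      (fun s m hl hr => hom_ext ?_ ?_)⟩⟩, ?_⟩
  · exact pullback.hom_ext (by simp [P, pullback.lift_fst_assoc, pullback.lift_fst, s.fst.comm₁])
      (by simp [P, pullback.lift_snd_assoc, pullback.lift_snd, s.snd.comm₁])
  · exact pullback.hom_ext (by simp [P, pullback.lift_fst_assoc, pullback.lift_fst, s.fst.comm₀])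
      (by simp [P, pullback.lift_snd_assoc, pullback.lift_snd, s.snd.comm₀])
  · exact pullback.hom_ext
      ((congrArg Hom.φ₁ hl).trans (pullback.lift_fst _ _ (congrArg Hom.φ₁ s.condition)).symm)
      ((congrArg Hom.φ₁ hr).trans (pullback.lift_snd _ _ (congrArg Hom.φ₁ s.condition)).symm)
  · exact pullback.hom_ext
      ((congrArg Hom.φ₀ hl).trans (pullback.lift_fst _ _ (congrArg Hom.φ₀ s.condition)).symm)
      ((congrArg Hom.φ₀ hr).trans (pullback.lift_snd _ _ (congrArg Hom.φ₀ s.condition)).symm)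
  · exact (deflation_iff _).2 ⟨(ModuleCat.epi_iff_surjective _).1 inferInstance,
      (ModuleCat.epi_iff_surjective _).1 inferInstance⟩

lemma isExactCategory : IsExactCategory (mfConflation ω) where
  hasZeroObject := inferInstance
  hasBinaryBiproducts := inferInstance
  closedUnderIso := mfConflation_isClosedUnderIsomorphisms
  isKernel _ := isKernel
  isCokernel _ := isCokernel
  inflation_id A := (inflation_iff _).2 ⟨.id _, .id _⟩
  deflation_id A := (deflation_iff _).2 ⟨Function.surjective_id, Function.surjective_id⟩
  inflation_comp i j hi hj := by
    rw [inflation_iff] at hi hj ⊢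
    exact ⟨hi.1.comp hj.1, hi.2.comp hj.2⟩
  deflation_comp p q hp hq := by
    rw [deflation_iff] at hp hq ⊢
    exact ⟨hq.1.comp hp.1, hq.2.comp hp.2⟩
  pushout := exists_pushout
  pullback := exists_pullback

variable (ω) in
/-- The contractible matrix factorization `(𝟙, ω)` on a free module. -/
def trivial₁ (n : ℕ) : MFG ω where
  G₁ := ModuleCat.of S (Fin n → S)
  G₀ := ModuleCat.of S (Fin n → S)
  gorenstein₁ := .of_free n
  gorenstein₀ := .of_free n
  d₁ := 𝟙 _
  d₀ := ω • 𝟙 _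
  d₁_d₀ := by simp
  d₀_d₁ := by simp

variable (ω) in
/-- The contractible matrix factorization `(ω, 𝟙)` on a free module. -/
def trivial₀ (n : ℕ) : MFG ω where
  G₁ := ModuleCat.of S (Fin n → S)
  G₀ := ModuleCat.of S (Fin n → S)
  gorenstein₁ := .of_free n
  gorenstein₀ := .of_free n
  d₁ := ω • 𝟙 _
  d₀ := 𝟙 _
  d₁_d₀ := by simp
  d₀_d₁ := by simp

/-- Morphisms out of `(𝟙, ω)` are given by their first component. -/
def fromTrivial₁ {n : ℕ} {X : MFG ω} (f : ModuleCat.of S (Fin n → S) ⟶ X.G₁) :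
    trivial₁ ω n ⟶ X :=
  ⟨f, f ≫ X.d₁, by simp [trivial₁], by simp [trivial₁]⟩

/-- Morphisms out of `(ω, 𝟙)` are given by their second component. -/
def fromTrivial₀ {n : ℕ} {X : MFG ω} (f : ModuleCat.of S (Fin n → S) ⟶ X.G₀) :
    trivial₀ ω n ⟶ X :=
  ⟨f ≫ X.d₀, f, by simp [trivial₀], by simp [trivial₀]⟩

/-- Morphisms into `(𝟙, ω)` are given by their second component. -/
def toTrivial₁ {n : ℕ} {X : MFG ω} (f : X.G₀ ⟶ ModuleCat.of S (Fin n → S)) :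
    X ⟶ trivial₁ ω n :=
  ⟨X.d₁ ≫ f, f, by simp [trivial₁], by simp [trivial₁]⟩

/-- Morphisms into `(ω, 𝟙)` are given by their first component. -/
def toTrivial₀ {n : ℕ} {X : MFG ω} (f : X.G₁ ⟶ ModuleCat.of S (Fin n → S)) :
    X ⟶ trivial₀ ω n :=
  ⟨f, X.d₀ ≫ f, by simp [trivial₀], by simp [trivial₀]⟩

instance (n : ℕ) : Projective (ModuleCat.of S (Fin n → S)) :=
  (IsProjective.iff_projective _).1 inferInstance

lemma isProj_trivial₁ (n : ℕ) : IsProj (mfConflation ω) (trivial₁ ω n) := by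
  intro B Z p f hp
  have : Epi p.φ₁ := (ModuleCat.epi_iff_surjective _).2 ((deflation_iff p).1 hp).1
  obtain ⟨g, hg⟩ : ∃ g : ModuleCat.of S (Fin n → S) ⟶ B.G₁, g ≫ p.φ₁ = f.φ₁ :=
    Projective.factors (P := ModuleCat.of S (Fin n → S)) f.φ₁ p.φ₁
  have hf : f.φ₀ = f.φ₁ ≫ Z.d₁ := (Category.id_comp _).symm.trans f.comm₁
  have h : (g ≫ B.d₁) ≫ p.φ₀ = (g ≫ p.φ₁) ≫ Z.d₁ := by
    rw [Category.assoc, p.comm₁, Category.assoc]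
  exact ⟨fromTrivial₁ g, hom_ext hg (h.trans ((congrArg (· ≫ Z.d₁) hg).trans hf.symm))⟩

lemma isProj_trivial₀ (n : ℕ) : IsProj (mfConflation ω) (trivial₀ ω n) := by
  intro B Z p f hp
  have : Epi p.φ₀ := (ModuleCat.epi_iff_surjective _).2 ((deflation_iff p).1 hp).2
  obtain ⟨g, hg⟩ : ∃ g : ModuleCat.of S (Fin n → S) ⟶ B.G₀, g ≫ p.φ₀ = f.φ₀ :=
    Projective.factors (P := ModuleCat.of S (Fin n → S)) f.φ₀ p.φ₀
  have hf : f.φ₁ = f.φ₀ ≫ Z.d₀ := (Category.id_comp _).symm.trans f.comm₀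
  have h : (g ≫ B.d₀) ≫ p.φ₁ = (g ≫ p.φ₀) ≫ Z.d₀ := by
    rw [Category.assoc, p.comm₀, Category.assoc]
  exact ⟨fromTrivial₀ g, hom_ext (h.trans ((congrArg (· ≫ Z.d₀) hg).trans hf.symm)) hg⟩

lemma isInj_trivial₁ (n : ℕ) : IsInj (mfConflation ω) (trivial₁ ω n) := by
  intro A B i f hi
  obtain ⟨g, hg⟩ := ((inflation_iff i).1 hi).2.exists_extension f.φ₀
  have hf : A.d₁ ≫ f.φ₀ = f.φ₁ := f.comm₁.trans (Category.comp_id _)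
  have h : i.φ₁ ≫ B.d₁ ≫ g = A.d₁ ≫ i.φ₀ ≫ g := by
    rw [← reassoc_of% i.comm₁]
  exact ⟨toTrivial₁ g, hom_ext (h.trans ((congrArg (A.d₁ ≫ ·) hg).trans hf)) hg⟩

lemma isInj_trivial₀ (n : ℕ) : IsInj (mfConflation ω) (trivial₀ ω n) := by
  intro A B i f hi
  obtain ⟨g, hg⟩ := ((inflation_iff i).1 hi).1.exists_extension f.φ₁
  have hf : A.d₀ ≫ f.φ₁ = f.φ₀ := f.comm₀.trans (Category.comp_id _)
  have h : i.φ₀ ≫ B.d₀ ≫ g = A.d₀ ≫ i.φ₁ ≫ g := by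
    rw [← reassoc_of% i.comm₀]
  exact ⟨toTrivial₀ g, hom_ext hg (h.trans ((congrArg (A.d₀ ≫ ·) hg).trans hf))⟩

lemma exists_deflation (X : MFG ω) :
    ∃ (n m : ℕ) (p : trivial₁ ω n ⊞ trivial₀ ω m ⟶ X), Deflation (mfConflation ω) p := by
  obtain ⟨n, f, hf⟩ := X.gorenstein₁.exists_surjective
  obtain ⟨m, g, hg⟩ := X.gorenstein₀.exists_surjective
  refine ⟨n, m, biprod.desc (fromTrivial₁ f) (fromTrivial₀ g), (deflation_iff _).2 ⟨?_, ?_⟩⟩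
  · have h : Function.Surjective
        (Hom.φ₁ (biprod.inl ≫ biprod.desc (fromTrivial₁ f) (fromTrivial₀ g))).hom := by
      rw [biprod.inl_desc]
      exact hf
    rw [comp_φ₁] at h
    exact Function.Surjective.of_comp h
  · have h : Function.Surjective
        (Hom.φ₀ (biprod.inr ≫ biprod.desc (fromTrivial₁ f) (fromTrivial₀ g))).hom := by
      rw [biprod.inr_desc]
      exact hg
    rw [comp_φ₀] at h
    exact Function.Surjective.of_comp h

lemma exists_inflation (X : MFG ω) :
    ∃ (n m : ℕ) (i : X ⟶ trivial₁ ω n ⊞ trivial₀ ω m), Inflation (mfConflation ω) i := by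
  obtain ⟨n, f, hf⟩ := X.gorenstein₀.exists_isAdmissibleMono
  obtain ⟨m, g, hg⟩ := X.gorenstein₁.exists_isAdmissibleMono
  refine ⟨n, m, biprod.lift (toTrivial₁ f) (toTrivial₀ g), (inflation_iff _).2 ⟨?_, ?_⟩⟩
  · have h : IsAdmissibleMono
        (Hom.φ₁ (biprod.lift (toTrivial₁ f) (toTrivial₀ g) ≫ biprod.snd)) := by
      rw [biprod.lift_snd]
      exact hg
    rw [comp_φ₁] at h
    exact IsAdmissibleMono.of_comp h
  · have h : IsAdmissibleMono
        (Hom.φ₀ (biprod.lift (toTrivial₁ f) (toTrivial₀ g) ≫ biprod.fst)) := by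
      rw [biprod.lift_fst]
      exact hf
    rw [comp_φ₀] at h
    exact IsAdmissibleMono.of_comp h

lemma isProj_sum_trivial (n m : ℕ) : IsProj (mfConflation ω) (trivial₁ ω n ⊞ trivial₀ ω m) :=
  isProj_biprod _ (isProj_trivial₁ n) (isProj_trivial₀ m)

lemma isInj_sum_trivial (n m : ℕ) : IsInj (mfConflation ω) (trivial₁ ω n ⊞ trivial₀ ω m) := by
  intro A B i f hi
  obtain ⟨g, hg⟩ := isInj_trivial₁ n i (f ≫ biprod.fst) hi
  obtain ⟨h, hh⟩ := isInj_trivial₀ m i (f ≫ biprod.snd) hi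
  exact ⟨biprod.lift g h, biprod.hom_ext _ _ (by simp [hg]) (by simp [hh])⟩

/-- Matrix factorizations form a Frobenius category: the sums of the contractible factorizations
`(𝟙, ω)` and `(ω, 𝟙)` on free modules are both projective and injective, and they suffice to
cover and to embed every object. -/
instance : IsFrobenius (mfConflation ω) where
  exact := isExactCategory
  enoughProjectives X := by
    obtain ⟨n, m, p, hp⟩ := exists_deflation X
    exact ⟨_, p, isProj_sum_trivial n m, hp⟩
  enoughInjectives X := by
    obtain ⟨n, m, i, hi⟩ := exists_inflation X
    exact ⟨_, i, isInj_sum_trivial n m, hi⟩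
  proj_iff_inj X := by
    constructor
    · intro hX A B i f hi
      obtain ⟨n, m, p, hp⟩ := exists_deflation X
      obtain ⟨s, hs⟩ := hX p (𝟙 X) hp
      obtain ⟨g, hg⟩ := isInj_sum_trivial n m i (f ≫ s) hi
      exact ⟨g ≫ p, by rw [reassoc_of% hg, hs, Category.comp_id]⟩
    · intro hX B Z p f hp
      obtain ⟨n, m, i, hi⟩ := exists_inflation X
      obtain ⟨r, hr⟩ := hX i (𝟙 X) hi
      obtain ⟨g, hg⟩ := isProj_sum_trivial n m p (r ≫ f) hp
      exact ⟨i ≫ g, by rw [Category.assoc, hg, reassoc_of% hr]⟩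

end MFG

end MonMF

namespace MonMF

section Functor

/-! ### The functor from monomorphisms to matrix factorizations -/

variable {S : Type u} [CommRing S] {ω : S}

instance : (toMF ω).Additive where

instance : (toMF ω).Faithful where
  map_injective h := by
    ext1
    exact CommaMorphism.ext (congrArg MFG.Hom.φ₁ h) (congrArg MFG.Hom.φ₀ h)

instance : (toMF ω).Full where
  map_surjective f := ⟨⟨Arrow.homMk f.φ₁ f.φ₀ f.comm₁.symm⟩, rfl⟩

lemma MFG.d₁_injective (hω : ω ∈ nonZeroDivisors S) (Y : MFG ω) :
    Function.Injective Y.d₁.hom := by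
  rw [injective_iff_map_eq_zero]
  intro x hx
  refine Y.gorenstein₁.smul_injective hω ?_
  have h := congrArg (fun k => k.hom x) Y.d₁_d₀
  refine h.symm.trans ?_
  change Y.d₀.hom (Y.d₁.hom x) = 0
  rw [hx, map_zero]

/-- A matrix factorization `(g₁, g₀)` is the value of the functor at `g₁`: as `ω` is regular on
Gorenstein projective modules, `g₁` is injective, and `ω = g₁ g₀` annihilates its cokernel. -/
lemma toMF_essSurj (hω : ω ∈ nonZeroDivisors S) : (toMF ω).EssSurj where
  mem_essImage Y := by
    let X : MonG ω := ⟨Arrow.mk Y.d₁, Y.gorenstein₁, Y.gorenstein₀, Y.d₁_injective hω, fun x => by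
      obtain ⟨y, rfl⟩ := Submodule.Quotient.mk_surjective _ x
      rw [← Submodule.Quotient.mk_smul, Submodule.Quotient.mk_eq_zero]
      exact ⟨Y.d₀.hom y, congrArg (fun k => k.hom y) Y.d₀_d₁⟩⟩
    have hX : partner X = Y.d₀ :=
      (existsUnique_partner X).unique ⟨hom_partner X, partner_hom X⟩ ⟨Y.d₁_d₀, Y.d₀_d₁⟩
    exact ⟨X, ⟨{
      hom := ⟨𝟙 _, 𝟙 _, rfl, by
        change partner X ≫ 𝟙 _ = 𝟙 _ ≫ Y.d₀
        rw [hX, Category.comp_id, Category.id_comp]⟩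
      inv := ⟨𝟙 _, 𝟙 _, rfl, by
        change Y.d₀ ≫ 𝟙 _ = 𝟙 _ ≫ partner X
        rw [hX, Category.comp_id, Category.id_comp]⟩
      hom_inv_id := MFG.hom_ext (Category.id_comp _) (Category.id_comp _)
      inv_hom_id := MFG.hom_ext (Category.id_comp _) (Category.id_comp _) }⟩⟩

lemma monConflation_iff (X : ShortComplex (MonG ω)) :
    monConflation ω X ↔ mfConflation ω (X.map (toMF ω)) := Iff.rfl

end Functor

end MonMF

theorem theorem3p8 {S : Type u} [CommRing S] [IsLocalRing S] [IsNoetherianRing S] (ω : S)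
    (hω : ω ∈ IsLocalRing.maximalIdeal S) (hω' : ω ∈ nonZeroDivisors S) :
    -- `F` is an equivalence, it is exact, and it preserves projective objects
    (toMF ω).IsEquivalence ∧
    (∀ X : ShortComplex (MonG ω), monConflation ω X →
      ∃ w : (toMF ω).map X.f ≫ (toMF ω).map X.g = 0,
        mfConflation ω (ShortComplex.mk ((toMF ω).map X.f) ((toMF ω).map X.g) w)) ∧
    (∀ P : MonG ω, IsProj (monConflation ω) P → IsProj (mfConflation ω) ((toMF ω).obj P)) ∧
    -- both categories are Frobenius categories, their stable categories are triangulated, and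
    -- `F` induces a triangle equivalence between them
    ∃ (_ : IsFrobenius (monConflation ω)) (_ : IsFrobenius (mfConflation ω))
      (_ : StableTriangulation (monConflation ω)) (_ : StableTriangulation (mfConflation ω))
      (Fst : StableCategory (monConflation ω) ⥤ StableCategory (mfConflation ω)),
      toStable (monConflation ω) ⋙ Fst = toMF ω ⋙ toStable (mfConflation ω) ∧
      Fst.IsEquivalence ∧
      ∃ _ : Fst.CommShift ℤ, Fst.IsTriangulated := by
  have := toMF_essSurj hω'
  have hF : (toMF ω).IsEquivalence := { }
  have hE : IsExactCategory (mfConflation ω) := IsFrobenius.exact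
  have hFrob : IsFrobenius (monConflation ω) :=
    IsFrobenius.of_isEquivalence (F := toMF ω) monConflation_iff
  exact ⟨hF, fun X hX => ⟨(X.map (toMF ω)).zero, hX⟩,
    fun P hP => (isProj_map_iff (F := toMF ω) monConflation_iff hE).2 hP,
    hFrob, inferInstance, exists_triangle_equivalence (F := toMF ω) monConflation_iff⟩
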